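/- Let $(X,\Sigma,\mu)$ be a $\sigma$-finite measure space, let $\mathcal A\subseteq\Sigma$ be a $\sigma$-subalgebra such that $(X,\mathcal A,\mu|_{\mathcal A})$ is $\sigma$-finite, and let $E$ be the conditional expectation with respect to $\mathcal A$. A measurable function $f:X\to\mathbb C$ is called conditionable if $E(|f|)<\infty$ a.e.; then $E(f)$ is defined. Let $u,w:X\to\mathbb C$ be conditionable, and let $T=M_wEM_u$ be the operator $Tf=wE(uf)$ in $L^2(\mu)$ with domain $\mathcal D(T)=\{f\in L^2(\mu): uf \text{ is conditionable and } wE(uf)\in L^2(\mu)\}$. For an operator $T$ between Hilbert spaces $\mathcal H_1\to\mathcal H_2$ with domain $\mathcal D(T)$, range $\mathcal R(T)$ and null space $\mathcal N(T)$, a Moore–Penrose inverse of $T$ is a closed densely defined operator $T^\dagger:\mathcal H_2\to\mathcal H_1$ with domain $\mathcal D(T^\dagger)=\mathcal R(T)\oplus\mathcal R(T)^\perp$ such that $TT^\dagger y=P_{\overline{\mathcal R(T)}}\,y$ for $y\in\mathcal D(T^\dagger)$, $T^\dagger Tx=P_{\mathcal N(T)^\perp}x$ for $x\in\mathcal D(T)$,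 and $\mathcal N(T^\dagger)=\mathcal R(T)^\perp$. **Theorem 2.7.** Suppose that $T=M_wEM_u$ is densely defined (possibly unbounded). 1. If $E(|u|^2)<\infty$ a.e., then $T$ is closed. 2. If $T$ is closed, then $T$ has exactly one Moore–Penrose inverse $T^\dagger$, and $$T^\dagger = M_{\frac{\chi_S}{E(|u|^2)E(|w|^2)}}\,M_{\bar u}\,E\,M_{\bar w},\qquad S=S(E(|u|^2))\cap S(E(|w|^2)),$$ where $S(h)=\{x: h(x)\neq 0\}$. That is, $\mathcal D(T^\dagger)$ consists exactly of those $f\in L^2(\mu)$ for which $E(|wf|)<\infty$ a.e. on $S$ and $\frac{\chi_S}{E(|u|^2)E(|w|^2)}\,\bar u\,E(\bar w f)\in L^2(\mu)$, and for $f\in\mathcal D(T^\dagger)$ $$T^\dagger f=\frac{\chi_S}{E(|u|^2)E(|w|^2)}\,\bar u\,E(\bar w f)\quad\text{a.e.},$$ where the right-hand sides are read as $0$ outside $S$. -/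

import Mathlib

open MeasureTheory Filter
open scoped ENNReal ComplexConjugate

noncomputable section

namespace WCT

variable {X : Type*} {m0 : MeasurableSpace X}

/-- The conditional expectation of a real function that need not be integrable:
`E(f⁺) - E(f⁻)`, where `condLExp` is the conditional expectation of non-negative functions
(meaningful where `E|f| < ∞`). -/
def condR (m : MeasurableSpace X) (μ : Measure[m0] X) (f : X → ℝ) : X → ℝ := fun x =>
  (condLExp m μ (fun y => ENNReal.ofReal (f y)) x).toReal
    - (condLExp m μ (fun y => ENNReal.ofReal (-f y)) x).toReal

/-- The conditional expectation of a complex function, by real and imaginary parts. -/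
def condC (m : MeasurableSpace X) (μ : Measure[m0] X) (f : X → ℂ) : X → ℂ := fun x =>
  ⟨condR m μ (fun y => (f y).re) x, condR m μ (fun y => (f y).im) x⟩

/-- `f` is conditionable: `f` is (a.e.) measurable and `E|f| < ∞` almost everywhere. -/
def Conditionable (m : MeasurableSpace X) (μ : Measure[m0] X) (f : X → ℂ) : Prop :=
  AEMeasurable f μ ∧ ∀ᵐ x ∂μ, condLExp m μ (fun y => ‖f y‖ₑ) x < ∞

/-- `E(|f|²)`, with values in `[0, ∞]`. -/
def condSq (m : MeasurableSpace X) (μ : Measure[m0] X) (f : X → ℂ) : X → ℝ≥0∞ :=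
  condLExp m μ (fun y => ‖f y‖ₑ ^ 2)

variable {m : MeasurableSpace X} {μ : Measure[m0] X}

theorem condR_congr {f g : X → ℝ} (h : f =ᵐ[μ] g) : condR m μ f =ᵐ[μ] condR m μ g := by
  have h1 : condLExp m μ (fun y => ENNReal.ofReal (f y))
      =ᵐ[μ] condLExp m μ (fun y => ENNReal.ofReal (g y)) :=
    condLExp_congr_ae (by filter_upwards [h] with x hx; rw [hx])
  have h2 : condLExp m μ (fun y => ENNReal.ofReal (-f y))
      =ᵐ[μ] condLExp m μ (fun y => ENNReal.ofReal (-g y)) :=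
    condLExp_congr_ae (by filter_upwards [h] with x hx; rw [hx])
  filter_upwards [h1, h2] with x h1 h2
  simp only [condR, h1, h2]

theorem condC_congr {f g : X → ℂ} (h : f =ᵐ[μ] g) : condC m μ f =ᵐ[μ] condC m μ g := by
  have h1 : condR m μ (fun y => (f y).re) =ᵐ[μ] condR m μ (fun y => (g y).re) :=
    condR_congr (by filter_upwards [h] with x hx; rw [hx])
  have h2 : condR m μ (fun y => (f y).im) =ᵐ[μ] condR m μ (fun y => (g y).im) :=
    condR_congr (by filter_upwards [h] with x hx; rw [hx])
  filter_upwards [h1, h2] with x h1 h2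
  simp only [condC, h1, h2]

/-- The real version of being conditionable. -/
def CondR (m : MeasurableSpace X) (μ : Measure[m0] X) (f : X → ℝ) : Prop :=
  AEMeasurable f μ ∧ ∀ᵐ x ∂μ, condLExp m μ (fun y => ‖f y‖ₑ) x < ∞

theorem CondR.of_le {f : X → ℝ} {g : X → ℝ≥0∞} (hf : AEMeasurable f μ)
    (hg : ∀ᵐ x ∂μ, condLExp m μ g x < ∞) (hfg : ∀ᵐ x ∂μ, ‖f x‖ₑ ≤ g x) : CondR m μ f := by
  refine ⟨hf, ?_⟩
  have h := condLExp_mono (mΩ := m) (P := μ) (X := fun y => ‖f y‖ₑ) (Y := g) hfg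
  filter_upwards [h, hg] with x h1 h2 using h1.trans_lt h2

theorem CondR.pos {f : X → ℝ} (hf : CondR m μ f) :
    ∀ᵐ x ∂μ, condLExp m μ (fun y => ENNReal.ofReal (f y)) x < ∞ := by
  have h := condLExp_mono (mΩ := m) (P := μ) (X := fun y => ENNReal.ofReal (f y))
    (Y := fun y => ‖f y‖ₑ) (ae_of_all _ fun x => by
      simp only [← ofReal_norm]
      exact ENNReal.ofReal_le_ofReal (le_abs_self _))
  filter_upwards [h, hf.2] with x h1 h2 using h1.trans_lt h2

theorem CondR.neg {f : X → ℝ} (hf : CondR m μ f) : CondR m μ (fun y => -f y) :=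
  ⟨hf.1.neg, by simpa only [enorm_neg] using hf.2⟩

theorem CondR.add {f g : X → ℝ} (hf : CondR m μ f) (hg : CondR m μ g) :
    CondR m μ (fun y => f y + g y) := by
  refine CondR.of_le (g := (fun y => ‖f y‖ₑ) + (fun y => ‖g y‖ₑ)) (hf.1.add hg.1) ?_
    (ae_of_all _ fun x => enorm_add_le _ _)
  have h := condLExp_add_left (mΩ := m) (P := μ) (X := fun y => ‖f y‖ₑ) (Y := fun y => ‖g y‖ₑ) (measurable_enorm.comp_aemeasurable hf.1)
  filter_upwards [h, hf.2, hg.2] with x h1 h2 h3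
  rw [h1]
  exact ENNReal.add_lt_top.2 ⟨h2, h3⟩

theorem CondR.const_mul {f : X → ℝ} (hf : CondR m μ f) (c : ℝ) :
    CondR m μ (fun y => c * f y) := by
  refine ⟨hf.1.const_mul c, ?_⟩
  have h := condLExp_smul (mΩ := m) (P := μ) (X := fun y => ‖f y‖ₑ) (measurable_enorm.comp_aemeasurable hf.1) ‖c‖₊
  have e : (fun y => ‖c * f y‖ₑ) = (‖c‖₊ : ℝ≥0∞) • (fun y => ‖f y‖ₑ) := by
    ext y; simp [enorm_eq_nnnorm]
  rw [e]
  filter_upwards [h, hf.2] with x h1 h2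
  rw [h1]
  simpa using ENNReal.mul_lt_top ENNReal.coe_lt_top h2

theorem condR_neg {f : X → ℝ} : condR m μ (fun y => -f y) = fun x => -condR m μ f x := by
  ext x
  simp only [condR, neg_neg, neg_sub]

theorem condR_add {f g : X → ℝ} (hf : CondR m μ f) (hg : CondR m μ g) :
    condR m μ (fun y => f y + g y) =ᵐ[μ] fun x => condR m μ f x + condR m μ g x := by
  have key : (fun y => ENNReal.ofReal (f y + g y)) + ((fun y => ENNReal.ofReal (-f y))
        + fun y => ENNReal.ofReal (-g y))
      = (fun y => ENNReal.ofReal (-(f y + g y))) + ((fun y => ENNReal.ofReal (f y))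
        + fun y => ENNReal.ofReal (g y)) := by
    ext y
    simp only [Pi.add_apply]
    rw [← ENNReal.toReal_eq_toReal_iff' (by finiteness) (by finiteness)]
    rw [ENNReal.toReal_add (by finiteness) (by finiteness),
      ENNReal.toReal_add (by finiteness) (by finiteness),
      ENNReal.toReal_add (by finiteness) (by finiteness),
      ENNReal.toReal_add (by finiteness) (by finiteness)]
    simp only [ENNReal.toReal_ofReal']
    have h1 := max_zero_sub_max_neg_zero_eq_self (f y)
    have h2 := max_zero_sub_max_neg_zero_eq_self (g y)
    have h3 := max_zero_sub_max_neg_zero_eq_self (f y + g y)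
    linarith
  have hs := hf.add hg
  have mf := hf.1
  have mg := hg.1
  have a1 := condLExp_add_left (mΩ := m) (P := μ) (X := fun y => ENNReal.ofReal (f y + g y))
    (Y := (fun y => ENNReal.ofReal (-f y)) + fun y => ENNReal.ofReal (-g y))
    hs.1.ennreal_ofReal
  have a2 := condLExp_add_left (mΩ := m) (P := μ) (X := fun y => ENNReal.ofReal (-f y))
    (Y := fun y => ENNReal.ofReal (-g y)) hf.neg.1.ennreal_ofReal
  have a3 := condLExp_add_left (mΩ := m) (P := μ) (X := fun y => ENNReal.ofReal (-(f y + g y)))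
    (Y := (fun y => ENNReal.ofReal (f y)) + fun y => ENNReal.ofReal (g y))
    hs.neg.1.ennreal_ofReal
  have a4 := condLExp_add_left (mΩ := m) (P := μ) (X := fun y => ENNReal.ofReal (f y))
    (Y := fun y => ENNReal.ofReal (g y)) hf.1.ennreal_ofReal
  rw [key] at a1
  filter_upwards [a1, a2, a3, a4, hf.pos, hf.neg.pos, hg.pos, hg.neg.pos, hs.pos, hs.neg.pos]
    with x a1 a2 a3 a4 p1 p2 p3 p4 p5 p6
  simp only [Pi.add_apply] at a1 a2 a3 a4
  rw [a3, a4, a2] at a1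
  have := congrArg ENNReal.toReal a1
  rw [ENNReal.toReal_add p6.ne (by finiteness), ENNReal.toReal_add p1.ne p3.ne,
    ENNReal.toReal_add p5.ne (by finiteness), ENNReal.toReal_add p2.ne p4.ne] at this
  simp only [condR]
  linarith

theorem condR_const_mul_nonneg {f : X → ℝ} (hf : AEMeasurable f μ) {c : ℝ} (hc : 0 ≤ c) :
    condR m μ (fun y => c * f y) =ᵐ[μ] fun x => c * condR m μ f x := by
  have h1 := condLExp_smul (mΩ := m) (P := μ) (X := fun y => ENNReal.ofReal (f y))
    hf.ennreal_ofReal (Real.toNNReal c)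
  have h2 := condLExp_smul (mΩ := m) (P := μ) (X := fun y => ENNReal.ofReal (-f y))
    hf.neg.ennreal_ofReal (Real.toNNReal c)
  have hc' : (Real.toNNReal c : ℝ≥0∞) = ENNReal.ofReal c := rfl
  have e1 : (fun y => ENNReal.ofReal (c * f y))
      = (Real.toNNReal c : ℝ≥0∞) • (fun y => ENNReal.ofReal (f y)) := by
    ext y; simp [hc', ENNReal.ofReal_mul hc]
  have e2 : (fun y => ENNReal.ofReal (-(c * f y)))
      = (Real.toNNReal c : ℝ≥0∞) • (fun y => ENNReal.ofReal (-f y)) := by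
    ext y; simp only [Pi.smul_apply, smul_eq_mul, hc', ← ENNReal.ofReal_mul hc, mul_neg]
  rw [← e1] at h1
  rw [← e2] at h2
  filter_upwards [h1, h2] with x h1 h2
  simp only [condR, h1, h2, Pi.smul_apply, smul_eq_mul, ENNReal.toReal_mul, hc',
    ENNReal.toReal_ofReal hc]
  ring

theorem condR_const_mul {f : X → ℝ} (hf : AEMeasurable f μ) (c : ℝ) :
    condR m μ (fun y => c * f y) =ᵐ[μ] fun x => c * condR m μ f x := by
  rcases le_total 0 c with hc | hc
  · exact condR_const_mul_nonneg hf hc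
  · have h := condR_const_mul_nonneg (m := m) hf (neg_nonneg.2 hc)
    have e : (fun y => c * f y) = fun y => -(-c * f y) := by ext y; ring
    rw [e, condR_neg]
    filter_upwards [h] with x h
    rw [h]; ring

theorem Conditionable.re {f : X → ℂ} (hf : Conditionable m μ f) :
    CondR m μ (fun y => (f y).re) :=
  CondR.of_le (Complex.measurable_re.comp_aemeasurable hf.1) hf.2 (ae_of_all _ fun x => by
    simp only [← ofReal_norm]
    exact ENNReal.ofReal_le_ofReal (Complex.abs_re_le_norm _))

theorem Conditionable.im {f : X → ℂ} (hf : Conditionable m μ f) :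
    CondR m μ (fun y => (f y).im) :=
  CondR.of_le (Complex.measurable_im.comp_aemeasurable hf.1) hf.2 (ae_of_all _ fun x => by
    simp only [← ofReal_norm]
    exact ENNReal.ofReal_le_ofReal (Complex.abs_im_le_norm _))

theorem Conditionable.congr {f g : X → ℂ} (hf : Conditionable m μ f) (h : f =ᵐ[μ] g) :
    Conditionable m μ g := by
  refine ⟨hf.1.congr h, ?_⟩
  have h1 : condLExp m μ (fun y => ‖f y‖ₑ) =ᵐ[μ] condLExp m μ (fun y => ‖g y‖ₑ) :=
    condLExp_congr_ae (by filter_upwards [h] with x hx; rw [hx])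
  filter_upwards [h1, hf.2] with x h1 h2
  rwa [← h1]

theorem Conditionable.zero : Conditionable m μ (fun _ => 0) := by
  refine ⟨aemeasurable_const, ?_⟩
  have : (fun _ : X => ‖(0 : ℂ)‖ₑ) = 0 := by ext y; simp
  rw [this, condLExp_zero]
  simp

theorem Conditionable.add {f g : X → ℂ} (hf : Conditionable m μ f) (hg : Conditionable m μ g) :
    Conditionable m μ (fun y => f y + g y) := by
  refine ⟨hf.1.add hg.1, ?_⟩
  have h := condLExp_add_left (mΩ := m) (P := μ) (X := fun y => ‖f y‖ₑ) (Y := fun y => ‖g y‖ₑ) (measurable_enorm.comp_aemeasurable hf.1)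
  have h' := condLExp_mono (mΩ := m) (P := μ) (X := fun y => ‖f y + g y‖ₑ)
    (Y := (fun y => ‖f y‖ₑ) + fun y => ‖g y‖ₑ) (ae_of_all _ fun x => enorm_add_le _ _)
  filter_upwards [h, h', hf.2, hg.2] with x h1 h' h2 h3
  rw [h1] at h'
  exact h'.trans_lt (ENNReal.add_lt_top.2 ⟨h2, h3⟩)

theorem Conditionable.const_mul {f : X → ℂ} (hf : Conditionable m μ f) (c : ℂ) :
    Conditionable m μ (fun y => c * f y) := by
  refine ⟨hf.1.const_mul c, ?_⟩
  have h := condLExp_smul (mΩ := m) (P := μ) (X := fun y => ‖f y‖ₑ) (measurable_enorm.comp_aemeasurable hf.1) ‖c‖₊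
  have e : (fun y => ‖c * f y‖ₑ) = (‖c‖₊ : ℝ≥0∞) • (fun y => ‖f y‖ₑ) := by
    ext y; simp [enorm_eq_nnnorm]
  rw [e]
  filter_upwards [h, hf.2] with x h1 h2
  rw [h1]
  simpa using ENNReal.mul_lt_top ENNReal.coe_lt_top h2

theorem condC_add {f g : X → ℂ} (hf : Conditionable m μ f) (hg : Conditionable m μ g) :
    condC m μ (fun y => f y + g y) =ᵐ[μ] fun x => condC m μ f x + condC m μ g x := by
  filter_upwards [condR_add hf.re hg.re, condR_add hf.im hg.im] with x h1 h2
  apply Complex.ext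
  · simpa [condC] using h1
  · simpa [condC] using h2

theorem condC_const_mul {f : X → ℂ} (hf : Conditionable m μ f) (c : ℂ) :
    condC m μ (fun y => c * f y) =ᵐ[μ] fun x => c * condC m μ f x := by
  have r1 := condR_add (hf.re.const_mul c.re) (hf.im.const_mul (-c.im))
  have r2 := condR_add (hf.im.const_mul c.re) (hf.re.const_mul c.im)
  filter_upwards [r1, r2, condR_const_mul (m := m) hf.re.1 c.re,
    condR_const_mul (m := m) hf.im.1 (-c.im), condR_const_mul (m := m) hf.im.1 c.re,
    condR_const_mul (m := m) hf.re.1 c.im] with x r1 r2 h1 h2 h3 h4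
  rw [h1, h2] at r1
  rw [h3, h4] at r2
  apply Complex.ext
  · have e : (fun y => (c * f y).re) = fun y => c.re * (f y).re + -c.im * (f y).im := by
      ext y; rw [Complex.mul_re]; ring
    rw [Complex.mul_re]
    simp only [condC]
    rw [e, r1]; ring
  · have e : (fun y => (c * f y).im) = fun y => c.re * (f y).im + c.im * (f y).re := by
      ext y; rw [Complex.mul_im]
    rw [Complex.mul_im]
    simp only [condC]
    rw [e, r2]

theorem condC_zero : condC m μ (fun _ => 0) = fun _ => 0 := by
  have : (fun _ : X => (0 : ℝ≥0∞)) = 0 := rfl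
  ext x
  simp [condC, condR, this, condLExp_zero, Complex.ext_iff]

/-- The function `w E(u f)`. -/
def wctFun (m : MeasurableSpace X) (μ : Measure[m0] X) (w u : X → ℂ) (f : X → ℂ) : X → ℂ :=
  fun x => w x * condC m μ (fun y => u y * f y) x

theorem wctFun_add {w u : X → ℂ} {f g : Lp ℂ 2 μ} (hf : Conditionable m μ (fun y => u y * f y))
    (hg : Conditionable m μ (fun y => u y * g y)) :
    wctFun m μ w u (f + g : Lp ℂ 2 μ) =ᵐ[μ] wctFun m μ w u f + wctFun m μ w u g := by
  have h : (fun y => u y * (f + g : Lp ℂ 2 μ) y) =ᵐ[μ] fun y => u y * f y + u y * g y := by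
    filter_upwards [Lp.coeFn_add f g] with x hx
    rw [hx, Pi.add_apply, mul_add]
  filter_upwards [condC_congr (m := m) h, condC_add hf hg] with x h1 h2
  simp only [wctFun, Pi.add_apply, h1, h2, mul_add]

theorem wctFun_smul {w u : X → ℂ} {f : Lp ℂ 2 μ} (hf : Conditionable m μ (fun y => u y * f y))
    (c : ℂ) : wctFun m μ w u (c • f : Lp ℂ 2 μ) =ᵐ[μ] c • wctFun m μ w u f := by
  have h : (fun y => u y * (c • f : Lp ℂ 2 μ) y) =ᵐ[μ] fun y => c * (u y * f y) := by
    filter_upwards [Lp.coeFn_smul c f] with x hx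
    rw [hx, Pi.smul_apply, smul_eq_mul]; ring
  filter_upwards [condC_congr (m := m) h, condC_const_mul hf c] with x h1 h2
  simp only [wctFun, Pi.smul_apply, smul_eq_mul, h1, h2]; ring

/-- The domain of `M_w E M_u`: all `f ∈ L²(μ)` such that `u f` is conditionable and
`w E(u f) ∈ L²(μ)`. -/
def wctDomain (m : MeasurableSpace X) (μ : Measure[m0] X) (w u : X → ℂ) :
    Submodule ℂ (Lp ℂ 2 μ) where
  carrier := {f | Conditionable m μ (fun y => u y * f y) ∧ MemLp (wctFun m μ w u f) 2 μ}
  zero_mem' := by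
    have h : (fun y => u y * (0 : Lp ℂ 2 μ) y) =ᵐ[μ] fun _ => 0 := by
      filter_upwards [Lp.coeFn_zero ℂ 2 μ] with x hx
      rw [hx]; simp
    refine ⟨Conditionable.zero.congr h.symm, ?_⟩
    refine (memLp_congr_ae (g := fun _ => (0 : ℂ)) ?_).2 (by simp)
    filter_upwards [condC_congr (m := m) h] with x hx
    simp only [wctFun, hx, condC_zero, mul_zero]
  add_mem' := by
    intro f g hf hg
    refine ⟨(hf.1.add hg.1).congr ?_, (memLp_congr_ae (wctFun_add hf.1 hg.1)).2 (hf.2.add hg.2)⟩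
    filter_upwards [Lp.coeFn_add f g] with x hx
    rw [hx, Pi.add_apply, mul_add]
  smul_mem' := by
    intro c f hf
    refine ⟨(hf.1.const_mul c).congr ?_,
      (memLp_congr_ae (wctFun_smul hf.1 c)).2 (hf.2.const_smul c)⟩
    filter_upwards [Lp.coeFn_smul c f] with x hx
    rw [hx, Pi.smul_apply, smul_eq_mul]; ring

/-- The weighted conditional type operator `M_w E M_u : f ↦ w E(u f)`, as a partially defined
(possibly unbounded) linear operator on the complex Hilbert space `L²(μ)`. -/
def wct (m : MeasurableSpace X) (μ : Measure[m0] X) (w u : X → ℂ) :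
    Lp ℂ 2 μ →ₗ.[ℂ] Lp ℂ 2 μ where
  domain := wctDomain m μ w u
  toFun :=
    { toFun := fun f => MemLp.toLp (wctFun m μ w u (f : Lp ℂ 2 μ)) f.2.2
      map_add' := fun f g => by
        rw [← MemLp.toLp_add]
        exact MemLp.toLp_congr _ _ (wctFun_add f.2.1 g.2.1)
      map_smul' := fun c f => by
        rw [RingHom.id_apply, ← MemLp.toLp_const_smul]
        exact MemLp.toLp_congr _ _ (wctFun_smul f.2.1 c) }

/-- The set `S(E(|u|²)) ∩ S(E(|w|²))`. -/
def suppSet (m : MeasurableSpace X) (μ : Measure[m0] X) (w u : X → ℂ) : Set X :=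
  {x | condSq m μ u x ≠ 0} ∩ {x | condSq m μ w x ≠ 0}

/-- The function `χ_S / (E(|u|²) E(|w|²))`. -/
def weightFun (m : MeasurableSpace X) (μ : Measure[m0] X) (w u : X → ℂ) : X → ℝ :=
  (suppSet m μ w u).indicator fun x => 1 / ((condSq m μ u x).toReal * (condSq m μ w x).toReal)

/-- The function `χ_S / (E(|u|²) E(|w|²)) · ū · E(w̄ g)`. -/
def mpFun (m : MeasurableSpace X) (μ : Measure[m0] X) (w u : X → ℂ) (g : X → ℂ) : X → ℂ :=
  fun x => (weightFun m μ w u x : ℂ) * (conj (u x) * condC m μ (fun y => conj (w y) * g y) x)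

end WCT

section MoorePenrose

variable {H₁ H₂ : Type*}
  [NormedAddCommGroup H₁] [InnerProductSpace ℂ H₁] [CompleteSpace H₁]
  [NormedAddCommGroup H₂] [InnerProductSpace ℂ H₂] [CompleteSpace H₂]

/-- The range of a partially defined operator. -/
def pmapRange (T : H₁ →ₗ.[ℂ] H₂) : Submodule ℂ H₂ := LinearMap.range T.toFun

/-- The null space of a partially defined operator, as a subspace of the ambient space. -/
def pmapKer (T : H₁ →ₗ.[ℂ] H₂) : Submodule ℂ H₁ :=
  (LinearMap.ker T.toFun).map T.domain.subtype

/-- `D` is a Moore-Penrose inverse of `T`: it is closed and densely defined, its domain is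
`R(T) ⊕ R(T)ᗮ`, `T D y` is the projection of `y` on the closure of `R(T)` for `y` in the domain
of `D`, `D T x` is the projection of `x` on `N(T)ᗮ` for `x` in the domain of `T`, and
`N(D) = R(T)ᗮ`. -/
structure IsMoorePenroseInverse (T : H₁ →ₗ.[ℂ] H₂) (D : H₂ →ₗ.[ℂ] H₁) : Prop where
  isClosed : D.IsClosed
  dense : Dense (D.domain : Set H₂)
  domain_eq : D.domain = pmapRange T ⊔ (pmapRange T)ᗮ
  apply_inverse : ∀ y : D.domain, ∃ h : D y ∈ T.domain,
    T ⟨D y, h⟩ = (pmapRange T).topologicalClosure.starProjection (y : H₂)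
  inverse_apply : ∀ x : T.domain, ∃ h : T x ∈ D.domain,
    D ⟨T x, h⟩ = (pmapKer T)ᗮ.starProjection (x : H₁)
  ker_eq : pmapKer D = (pmapRange T)ᗮ

end MoorePenrose

end

open scoped Topology

/-! ### Conditional expectation of nonnegative functions: pull-out and Cauchy–Schwarz. -/

namespace WCT

section LExp

variable {X : Type*} {m : MeasurableSpace X} {m0 : MeasurableSpace X} {μ : Measure[m0] X}

/-! The basic tool is conditional Cauchy–Schwarz, `|E(uf)|² ≤ C E(|u|²) E(|f|²)`; the value of `C`
never matters. If `E(|u|²) < ∞`, it makes every `uf` with `f ∈ L²` conditionable. It also shows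
that, along a sequence with `E(|fₙ - f|²) → 0` a.e., `E(ufₙ) → E(uf)` a.e.; hence `T` is closed
(`isClosed_wct`).

Conversely, closedness forces `E(|u|²) < ∞` (`condSq_lt_top_of_isClosed`). The kernel of a closed
operator is closed, and on `{E(|u|²) = ∞}` a function `g` can be moved into the kernel by a
correction of arbitrarily small norm, a multiple of a truncation of `ū`. So every `L²` function
supported there lies in the kernel, and `ug` is conditionable for all of them. If that set had
positive measure, a lacunary sum would give such a `g` with `E(|ug|) = ∞` on a set of positive
measure.

Density of the domain gives `E(|u|²) = 0` wherever `E(|w|²) = ∞` (`condSq_eq_zero_of_dense`).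
Multiplying `u` and `w` by `χ_S` therefore leaves `T` unchanged and reduces to weights `u`, `v` with
finite `E(|u|²)`, `E(|v|²)` having the same zero set. Then, with `D` given by the formula, `TDy = v
E(v̄y)/E(|v|²)` and `DTx = ū E(ux)/E(|u|²)`. These are the orthogonal projections onto the closure
of the range and onto the complement of the kernel (`isMoorePenroseInverse_mpInv`). `D` is closed
because it is again an operator of the form `M E M`. Uniqueness is abstract: the axioms determine a
Moore–Penrose inverse on `R(T)` and on its complement. -/

/-- The measures `f·μ` and `E(f)·μ` agree on `m`, so they integrate every `m`-measurable `a` alike.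
No finiteness is needed. -/
theorem condLExp_mul_left (hm : m ≤ m0) [SigmaFinite (μ.trim hm)] {a f : X → ℝ≥0∞}
    (ha : Measurable[m] a) (hf : AEMeasurable f μ) :
    condLExp m μ (fun x => a x * f x) =ᵐ[μ] fun x => a x * condLExp m μ f x := by
  have hE : Measurable (condLExp m μ f) := measurable_condLExp' m μ f
  have key : (μ.withDensity f).trim hm = (μ.withDensity (condLExp m μ f)).trim hm := by
    refine @Measure.ext _ m _ _ fun s hs => ?_
    rw [trim_measurableSet_eq hm hs, trim_measurableSet_eq hm hs,
      withDensity_apply _ (hm s hs), withDensity_apply _ (hm s hs),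
      setLIntegral_condLExp hm μ f hs]
  refine (ae_eq_condLExp hm μ _ (ha.mul (measurable_condLExp m μ f)) fun s hs => ?_).symm
  have h (g : X → ℝ≥0∞) (hg : AEMeasurable g μ) :
      ∫⁻ x in s, a x * g x ∂μ = ∫⁻ x, s.indicator a x ∂((μ.withDensity g).trim hm) := by
    rw [lintegral_trim hm (ha.indicator hs),
      lintegral_withDensity_eq_lintegral_mul₀ hg ((ha.indicator hs).mono hm le_rfl).aemeasurable,
      ← lintegral_indicator (hm s hs)]
    congr 1 with x
    by_cases hx : x ∈ s <;> simp [hx, mul_comm]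
  exact (h _ hE.aemeasurable).trans ((h f hf).trans (by rw [key])).symm

theorem ae_eq_zero_of_condLExp_eq_zero (hm : m ≤ m0) [SigmaFinite (μ.trim hm)] {f : X → ℝ≥0∞}
    (hf : AEMeasurable f μ) : ∀ᵐ x ∂μ, condLExp m μ f x = 0 → f x = 0 := by
  have hs : MeasurableSet[m] {x | condLExp m μ f x = 0} :=
    measurable_condLExp m μ f (measurableSet_singleton 0)
  have h : ∫⁻ x in {x | condLExp m μ f x = 0}, f x ∂μ = 0 := by
    rw [← setLIntegral_condLExp hm μ f hs, setLIntegral_congr_fun (hm _ hs) (g := 0)]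
    · simp
    · intro x hx; exact hx
  rw [lintegral_eq_zero_iff' hf.restrict, EventuallyEq, ae_restrict_iff' (hm _ hs)] at h
  exact h

theorem condLExp_indicator (hm : m ≤ m0) [SigmaFinite (μ.trim hm)] {H : Set X}
    (hH : MeasurableSet[m] H) {f : X → ℝ≥0∞} (hf : AEMeasurable f μ) :
    condLExp m μ (H.indicator f) =ᵐ[μ] H.indicator (condLExp m μ f) := by
  have h1 : Measurable[m] (H.indicator fun _ => (1 : ℝ≥0∞)) := measurable_const.indicator hH
  have h := condLExp_mul_left hm (μ := μ) h1 hf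
  have e (g : X → ℝ≥0∞) : (fun x => H.indicator (fun _ => (1 : ℝ≥0∞)) x * g x) = H.indicator g := by
    ext x; by_cases hx : x ∈ H <;> simp [hx]
  rwa [e, e] at h

theorem condLExp_mul_eq_zero (hm : m ≤ m0) [SigmaFinite (μ.trim hm)] {f g : X → ℝ≥0∞}
    (hf : AEMeasurable f μ) (hg : AEMeasurable g μ) :
    ∀ᵐ x ∂μ, condLExp m μ (fun y => f y ^ 2) x = 0 →
      condLExp m μ (fun y => f y * g y) x = 0 := by
  have hH : MeasurableSet[m] {x | condLExp m μ (fun y => f y ^ 2) x = 0} :=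
    measurable_condLExp m μ _ (measurableSet_singleton 0)
  have e := condLExp_indicator hm hH (hf.mul hg)
  have e' := condLExp_congr_ae (mΩ := m) (P := μ) (Y := 0)
    (X := {x | condLExp m μ (fun y => f y ^ 2) x = 0}.indicator (f * g)) (by
      filter_upwards [ae_eq_zero_of_condLExp_eq_zero hm (hf.pow_const 2)] with x hx
      by_cases h : condLExp m μ (fun y => f y ^ 2) x = 0
      · have := hx h
        simp only [ne_eq, OfNat.ofNat_ne_zero, not_false_eq_true, pow_eq_zero_iff] at this
        simp [this]
      · simp [h])
  rw [condLExp_zero] at e'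
  filter_upwards [e, e'] with x e e' hx
  rw [e'] at e
  rw [Set.indicator_of_mem (by exact hx)] at e
  exact e.symm

/-- Apply `E` to `fg ≤ s f² + s⁻¹ g²` with an `m`-measurable `s`. Using the cruder inequality
without the factor `1/2` costs the constant 4. -/
theorem condLExp_mul_sq_le (hm : m ≤ m0) [SigmaFinite (μ.trim hm)] {f g : X → ℝ≥0∞}
    (hf : AEMeasurable f μ) (hg : AEMeasurable g μ) :
    ∀ᵐ x ∂μ, condLExp m μ (fun y => f y ^ 2) x < ∞ → condLExp m μ (fun y => g y ^ 2) x < ∞ →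
      condLExp m μ (fun y => f y * g y) x ^ 2 ≤
        4 * (condLExp m μ (fun y => f y ^ 2) x * condLExp m μ (fun y => g y ^ 2) x) := by
  set p := condLExp m μ (fun y => f y ^ 2) with hp
  set q := condLExp m μ (fun y => g y ^ 2) with hq
  have mp : Measurable[m] p := measurable_condLExp m μ _
  have mq : Measurable[m] q := measurable_condLExp m μ _
  set G : Set X := {x | p x ≠ 0 ∧ q x ≠ 0 ∧ p x < ∞ ∧ q x < ∞} with hG
  have hmeasG : MeasurableSet[m] G :=
    (mp (measurableSet_singleton 0).compl).inter
      ((mq (measurableSet_singleton 0).compl).inter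
        ((mp measurableSet_Iio).inter (mq measurableSet_Iio)))
  -- The minimiser of `s p + s⁻¹ q`; on `G` it is neither `0` nor `∞`, and both terms become equal.
  set s : X → ℝ≥0∞ := fun x => (q x / p x) ^ (1 / 2 : ℝ) with hs
  have ms : Measurable[m] s := (mq.div mp).pow_const _
  have msi : Measurable[m] fun x => (s x)⁻¹ := ms.inv
  have hss (x) : s x * s x = q x / p x := by
    rw [hs]; dsimp only
    rw [← ENNReal.rpow_add_of_nonneg _ _ (by norm_num) (by norm_num)]
    norm_num
  have s0 {x} (hx : x ∈ G) : s x ≠ 0 := fun h => by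
    have := hss x
    rw [h, zero_mul, eq_comm, ENNReal.div_eq_zero_iff] at this
    exact this.elim hx.2.1 hx.2.2.1.ne
  have st {x} (hx : x ∈ G) : s x ≠ ∞ := fun h => by
    have := hss x
    rw [h, ENNReal.top_mul_top, eq_comm, ENNReal.div_eq_top] at this
    exact this.elim (fun h => hx.1 h.2) (fun h => hx.2.2.2.ne h.1)
  have mono := condLExp_mono (mΩ := m) (P := μ) (X := G.indicator (f * g))
    (Y := (fun x => s x * f x ^ 2) + fun x => (s x)⁻¹ * g x ^ 2) (ae_of_all _ fun x => by
      by_cases hx : x ∈ G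
      · simp only [Set.indicator_of_mem hx, Pi.mul_apply, Pi.add_apply]
        rcases le_total (g x) (s x * f x) with h | h
        · calc f x * g x ≤ f x * (s x * f x) := by gcongr
            _ = s x * f x ^ 2 := by ring
            _ ≤ _ := le_self_add
        · have h' : f x ≤ (s x)⁻¹ * g x := by
            rw [mul_comm, ← div_eq_mul_inv,
              ENNReal.le_div_iff_mul_le (.inl (s0 hx)) (.inl (st hx)), mul_comm]
            exact h
          calc f x * g x ≤ ((s x)⁻¹ * g x) * g x := by gcongr
            _ = (s x)⁻¹ * g x ^ 2 := by ring
            _ ≤ _ := le_add_self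
      · simp [Set.indicator_of_notMem hx])
  have e1 := condLExp_indicator hm hmeasG (hf.mul hg)
  have e2 := condLExp_mul_left hm (μ := μ) ms (hf.pow_const 2)
  have e3 := condLExp_mul_left hm (μ := μ) msi (hg.pow_const 2)
  have e4 := condLExp_add_left (mΩ := m) (P := μ) (X := fun x => s x * f x ^ 2)
    (fun x => (s x)⁻¹ * g x ^ 2) ((ms.mono hm le_rfl).aemeasurable.mul (hf.pow_const 2))
  filter_upwards [mono, e1, e2, e3, e4, condLExp_mul_eq_zero hm hf hg,
    condLExp_mul_eq_zero hm hg hf] with x mono e1 e2 e3 e4 z1 z2 hpt hqt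
  by_cases p0 : p x = 0
  · rw [z1 p0]; simp
  by_cases q0 : q x = 0
  · have := z2 q0
    simp only [mul_comm (g _)] at this
    rw [this]; simp
  have hx : x ∈ G := ⟨p0, q0, hpt, hqt⟩
  rw [e4, Pi.add_apply, e2, e3, e1, Set.indicator_of_mem hx] at mono
  have hq' : s x * s x * p x = q x := by rw [hss, ENNReal.div_mul_cancel p0 hpt.ne]
  have : (s x)⁻¹ * q x = s x * p x := by
    rw [← hq', mul_assoc, ← mul_assoc, ENNReal.inv_mul_cancel (s0 hx) (st hx), one_mul]
  change condLExp m μ (fun y => f y * g y) x ≤ s x * p x + (s x)⁻¹ * q x at mono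
  rw [this] at mono
  calc _ ≤ (s x * p x + s x * p x) ^ 2 := by gcongr
    _ = 4 * (p x * (s x * s x * p x)) := by ring
    _ = _ := by rw [hq']

theorem condLExp_mul_lt_top {f g : X → ℝ≥0∞} (hf : AEMeasurable f μ) :
    ∀ᵐ x ∂μ, condLExp m μ (fun y => f y ^ 2) x < ∞ → condLExp m μ (fun y => g y ^ 2) x < ∞ →
      condLExp m μ (fun y => f y * g y) x < ∞ := by
  have h1 := condLExp_mono (mΩ := m) (P := μ) (X := fun y => f y * g y)
    (Y := (fun y => f y ^ 2) + fun y => g y ^ 2) (ae_of_all _ fun x => by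
      simp only [Pi.add_apply]
      rcases le_total (f x) (g x) with h | h
      · calc f x * g x ≤ g x * g x := by gcongr
          _ = g x ^ 2 := by ring
          _ ≤ _ := le_add_self
      · calc f x * g x ≤ f x * f x := by gcongr
          _ = f x ^ 2 := by ring
          _ ≤ _ := le_self_add)
  have h2 := condLExp_add_left (mΩ := m) (P := μ) (X := fun y => f y ^ 2)
    (fun y => g y ^ 2) (hf.pow_const 2)
  filter_upwards [h1, h2] with x h1 h2 p q
  rw [h2] at h1
  exact h1.trans_lt (ENNReal.add_lt_top.2 ⟨p, q⟩)

end LExp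
end WCT

/-! ### Conditional expectation of real and complex functions. -/

namespace WCT

section CondC

variable {X : Type*} {m : MeasurableSpace X} {m0 : MeasurableSpace X} {μ : Measure[m0] X}

theorem measurable_condR (f : X → ℝ) : Measurable[m] (condR m μ f) :=
  (measurable_condLExp m μ _).ennreal_toReal.sub (measurable_condLExp m μ _).ennreal_toReal

theorem measurable_condC (f : X → ℂ) : Measurable[m] (condC m μ f) := by
  have e : condC m μ f = fun x => ((condR m μ (fun y => (f y).re) x : ℝ) : ℂ)
      + ((condR m μ (fun y => (f y).im) x : ℝ) : ℂ) * Complex.I := by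
    ext x; simp [condC, Complex.ext_iff]
  rw [e]
  exact (Complex.measurable_ofReal.comp (measurable_condR _)).add
    ((Complex.measurable_ofReal.comp (measurable_condR _)).mul_const _)

theorem condR_mul_nonneg (hm : m ≤ m0) [SigmaFinite (μ.trim hm)] {a f : X → ℝ}
    (ha : Measurable[m] a) (ha0 : ∀ x, 0 ≤ a x) (hf : AEMeasurable f μ) :
    condR m μ (fun y => a y * f y) =ᵐ[μ] fun x => a x * condR m μ f x := by
  have ma : Measurable[m] fun x => ENNReal.ofReal (a x) := ha.ennreal_ofReal
  have h1 := condLExp_mul_left hm (μ := μ) ma hf.ennreal_ofReal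
  have h2 := condLExp_mul_left hm (μ := μ) ma hf.neg.ennreal_ofReal
  simp only [← ENNReal.ofReal_mul (ha0 _), Pi.neg_apply, mul_neg] at h1 h2
  filter_upwards [h1, h2] with x h1 h2
  simp only [condR, h1, h2, ENNReal.toReal_mul, ENNReal.toReal_ofReal (ha0 x)]
  ring

theorem CondR.mul (hm : m ≤ m0) [SigmaFinite (μ.trim hm)] {a f : X → ℝ}
    (ha : Measurable[m] a) (hf : CondR m μ f) : CondR m μ (fun y => a y * f y) := by
  refine ⟨(ha.mono hm le_rfl).aemeasurable.mul hf.1, ?_⟩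
  have ma : Measurable[m] fun x => ‖a x‖ₑ := measurable_enorm.comp ha
  have h1 := condLExp_mul_left hm (μ := μ) ma hf.1.enorm
  simp only [enorm_mul]
  filter_upwards [h1, hf.2] with x h1 h2
  rw [h1]
  exact ENNReal.mul_lt_top enorm_lt_top h2

theorem condR_mul (hm : m ≤ m0) [SigmaFinite (μ.trim hm)] {a f : X → ℝ}
    (ha : Measurable[m] a) (hf : CondR m μ f) :
    condR m μ (fun y => a y * f y) =ᵐ[μ] fun x => a x * condR m μ f x := by
  have mp : Measurable[m] fun x => max (a x) 0 := ha.max measurable_const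
  have mn : Measurable[m] fun x => max (-a x) 0 := ha.neg.max measurable_const
  have h := condR_add (hf.mul hm mp) (hf.mul hm mn).neg
  have e : (fun y => a y * f y) = fun y => max (a y) 0 * f y + -(max (-a y) 0 * f y) := by
    ext y
    have := max_zero_sub_max_neg_zero_eq_self (a y)
    linear_combination -f y * this
  rw [e]
  rw [condR_neg] at h
  filter_upwards [h, condR_mul_nonneg hm mp (fun x => le_max_right _ _) hf.1,
    condR_mul_nonneg hm mn (fun x => le_max_right _ _) hf.1] with x h h1 h2
  rw [h, h1, h2]
  linear_combination condR m μ f x * max_zero_sub_max_neg_zero_eq_self (a x)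

theorem Conditionable.mul (hm : m ≤ m0) [SigmaFinite (μ.trim hm)] {a f : X → ℂ}
    (ha : Measurable[m] a) (hf : Conditionable m μ f) :
    Conditionable m μ (fun y => a y * f y) := by
  refine ⟨(ha.mono hm le_rfl).aemeasurable.mul hf.1, ?_⟩
  have ma : Measurable[m] fun x => ‖a x‖ₑ := measurable_enorm.comp ha
  have h1 := condLExp_mul_left hm (μ := μ) ma hf.1.enorm
  simp only [enorm_mul]
  filter_upwards [h1, hf.2] with x h1 h2
  rw [h1]
  exact ENNReal.mul_lt_top enorm_lt_top h2

theorem condC_mul (hm : m ≤ m0) [SigmaFinite (μ.trim hm)] {a f : X → ℂ}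
    (ha : Measurable[m] a) (hf : Conditionable m μ f) :
    condC m μ (fun y => a y * f y) =ᵐ[μ] fun x => a x * condC m μ f x := by
  have mr : Measurable[m] fun x => (a x).re := Complex.measurable_re.comp ha
  have mi : Measurable[m] fun x => (a x).im := Complex.measurable_im.comp ha
  have h1 := condR_add (hf.re.mul hm mr) (hf.im.mul hm mi).neg
  have h2 := condR_add (hf.im.mul hm mr) (hf.re.mul hm mi)
  rw [condR_neg] at h1
  filter_upwards [h1, h2, condR_mul hm mr hf.re, condR_mul hm mr hf.im,
    condR_mul hm mi hf.re, condR_mul hm mi hf.im] with x h1 h2 rr ri ir ii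
  apply Complex.ext
  · simp only [condC, Complex.mul_re, sub_eq_add_neg]
    rw [h1, rr, ii]
  · simp only [condC, Complex.mul_im]
    rw [h2, ri, ir]

/-- No conditionability is required: a nonnegative factor passes through positive and negative parts
separately. This matters for `w̄g`, which may fail to be conditionable off `S`. -/
theorem condC_indicator (hm : m ≤ m0) [SigmaFinite (μ.trim hm)] {H : Set X}
    (hH : MeasurableSet[m] H) {f : X → ℂ} (hf : AEMeasurable f μ) :
    condC m μ (H.indicator f) =ᵐ[μ] H.indicator (condC m μ f) := by
  have h1 : Measurable[m] (H.indicator fun _ => (1 : ℝ)) := measurable_const.indicator hH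
  have h0 (x) : 0 ≤ H.indicator (fun _ => (1 : ℝ)) x := Set.indicator_nonneg (by simp) x
  have hr := condR_mul_nonneg hm (μ := μ) h1 h0 (Complex.measurable_re.comp_aemeasurable hf)
  have hi := condR_mul_nonneg hm (μ := μ) h1 h0 (Complex.measurable_im.comp_aemeasurable hf)
  have er : (fun y => (H.indicator f y).re) =
      fun y => H.indicator (fun _ => (1 : ℝ)) y * (Complex.re ∘ f) y := by
    ext y; by_cases hy : y ∈ H <;> simp [hy]
  have ei : (fun y => (H.indicator f y).im) =
      fun y => H.indicator (fun _ => (1 : ℝ)) y * (Complex.im ∘ f) y := by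
    ext y; by_cases hy : y ∈ H <;> simp [hy]
  filter_upwards [hr, hi] with x hr hi
  apply Complex.ext
  · simp only [condC, er, hr]
    by_cases hy : x ∈ H <;> simp [hy, condC, Function.comp_def]
  · simp only [condC, ei, hi]
    by_cases hy : x ∈ H <;> simp [hy, condC, Function.comp_def]

theorem condC_conj (f : X → ℂ) : condC m μ (fun y => conj (f y)) = fun x => conj (condC m μ f x) := by
  ext x
  apply Complex.ext
  · simp [condC]
  · simp only [condC, Complex.conj_im]
    rw [condR_neg]

theorem enorm_condR_le {f : X → ℝ} (hf : CondR m μ f) :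
    ∀ᵐ x ∂μ, ‖condR m μ f x‖ₑ ≤ condLExp m μ (fun y => ‖f y‖ₑ) x := by
  have hp := condLExp_mono (mΩ := m) (P := μ) (X := fun y => ENNReal.ofReal (f y))
    (Y := fun y => ‖f y‖ₑ) (ae_of_all _ fun x => by
      simp only [← ofReal_norm]
      exact ENNReal.ofReal_le_ofReal (le_abs_self _))
  have hn := condLExp_mono (mΩ := m) (P := μ) (X := fun y => ENNReal.ofReal (-f y))
    (Y := fun y => ‖f y‖ₑ) (ae_of_all _ fun x => by
      simp only [← ofReal_norm]
      exact ENNReal.ofReal_le_ofReal (neg_le_abs _))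
  filter_upwards [hp, hn, hf.2] with x hp hn hx
  have h1 := ENNReal.toReal_mono hx.ne hp
  have h2 := ENNReal.toReal_mono hx.ne hn
  rw [← ofReal_norm, Real.norm_eq_abs]
  refine ENNReal.ofReal_le_of_le_toReal ?_
  rw [abs_le, condR]
  constructor <;> linarith [ENNReal.toReal_nonneg (a := condLExp m μ (fun y => ENNReal.ofReal (f y)) x),
    ENNReal.toReal_nonneg (a := condLExp m μ (fun y => ENNReal.ofReal (-f y)) x)]

theorem enorm_condC_le {f : X → ℂ} (hf : Conditionable m μ f) :
    ∀ᵐ x ∂μ, ‖condC m μ f x‖ₑ ≤ 2 * condLExp m μ (fun y => ‖f y‖ₑ) x := by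
  have hr := condLExp_mono (mΩ := m) (P := μ) (X := fun y => ‖(f y).re‖ₑ)
    (Y := fun y => ‖f y‖ₑ) (ae_of_all _ fun x => by
      simp only [← ofReal_norm]
      exact ENNReal.ofReal_le_ofReal (Complex.abs_re_le_norm _))
  have hi := condLExp_mono (mΩ := m) (P := μ) (X := fun y => ‖(f y).im‖ₑ)
    (Y := fun y => ‖f y‖ₑ) (ae_of_all _ fun x => by
      simp only [← ofReal_norm]
      exact ENNReal.ofReal_le_ofReal (Complex.abs_im_le_norm _))
  filter_upwards [hr, hi, enorm_condR_le hf.re, enorm_condR_le hf.im] with x hr hi h1 h2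
  have h : ‖condC m μ f x‖ₑ ≤ ‖(condC m μ f x).re‖ₑ + ‖(condC m μ f x).im‖ₑ := by
    simp only [← ofReal_norm]
    rw [← ENNReal.ofReal_add (norm_nonneg _) (norm_nonneg _)]
    exact ENNReal.ofReal_le_ofReal (Complex.norm_le_abs_re_add_abs_im _)
  rw [two_mul]
  exact h.trans (add_le_add (h1.trans hr) (h2.trans hi))

theorem condC_ofReal_toReal {g : X → ℝ≥0∞} (hg : ∀ x, g x ≠ ∞) :
    condC m μ (fun y => ((g y).toReal : ℂ)) = fun x => ((condLExp m μ g x).toReal : ℂ) := by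
  ext x
  have e0 : (fun _ : X => (0 : ℝ≥0∞)) = 0 := rfl
  apply Complex.ext
  · simp [condC, condR, ENNReal.ofReal_toReal (hg _), e0, condLExp_zero,
      ENNReal.ofReal_of_nonpos]
  · simp [condC, condR, e0, condLExp_zero]

theorem conditionable_mul {u f : X → ℂ} (hu : AEMeasurable u μ) (hf : AEMeasurable f μ)
    (hA : ∀ᵐ x ∂μ, condSq m μ u x < ∞) (hF : ∀ᵐ x ∂μ, condSq m μ f x < ∞) :
    Conditionable m μ (fun y => u y * f y) := by
  refine ⟨hu.mul hf, ?_⟩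
  simp only [enorm_mul]
  filter_upwards [hA, hF, condLExp_mul_lt_top (m := m) (g := fun y => ‖f y‖ₑ) hu.enorm]
    with x h1 h2 h3 using h3 h1 h2

theorem lintegral_enorm_sq_lt_top {f : X → ℂ} (hf : MemLp f 2 μ) : ∫⁻ x, ‖f x‖ₑ ^ 2 ∂μ < ∞ := by
  have := hf.2
  rw [eLpNorm_lt_top_iff_lintegral_rpow_enorm_lt_top (by norm_num) (by norm_num)] at this
  simpa using this

theorem memLp_two_iff {f : X → ℂ} (hf : AEMeasurable f μ) :
    MemLp f 2 μ ↔ ∫⁻ x, ‖f x‖ₑ ^ 2 ∂μ < ∞ := by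
  refine ⟨lintegral_enorm_sq_lt_top, fun h => ⟨hf.aestronglyMeasurable, ?_⟩⟩
  rw [eLpNorm_lt_top_iff_lintegral_rpow_enorm_lt_top (by norm_num) (by norm_num)]
  simpa using h

theorem condSq_lt_top {f : X → ℂ} (hf : MemLp f 2 μ) : ∀ᵐ x ∂μ, condSq m μ f x < ∞ :=
  condLExp_lt_top (lintegral_enorm_sq_lt_top hf).ne

/-- 16 is the 4 of `condLExp_mul_sq_le` times the square of the 2 lost by treating real and
imaginary parts separately. -/
theorem enorm_condC_mul_sq_le (hm : m ≤ m0) [SigmaFinite (μ.trim hm)] {u f : X → ℂ}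
    (hu : AEMeasurable u μ) (hf : AEMeasurable f μ)
    (hA : ∀ᵐ x ∂μ, condSq m μ u x < ∞) (hF : ∀ᵐ x ∂μ, condSq m μ f x < ∞) :
    ∀ᵐ x ∂μ, ‖condC m μ (fun y => u y * f y) x‖ₑ ^ 2 ≤ 16 * (condSq m μ u x * condSq m μ f x) := by
  filter_upwards [hA, hF, enorm_condC_le (conditionable_mul hu hf hA hF),
    condLExp_mul_sq_le hm hu.enorm hf.enorm] with x h1 h2 h3 h4
  simp only [enorm_mul] at h3
  calc _ ≤ (2 * condLExp m μ (fun y => ‖u y‖ₑ * ‖f y‖ₑ) x) ^ 2 := by gcongr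
    _ = 4 * condLExp m μ (fun y => ‖u y‖ₑ * ‖f y‖ₑ) x ^ 2 := by ring
    _ ≤ 4 * (4 * (condSq m μ u x * condSq m μ f x)) := by gcongr; exact h4 h1 h2
    _ = _ := by ring

theorem integral_condR (hm : m ≤ m0) [SigmaFinite (μ.trim hm)] {f : X → ℝ}
    (hf : Integrable f μ) : Integrable (condR m μ f) μ ∧ ∫ x, condR m μ f x ∂μ = ∫ x, f x ∂μ := by
  have h1 : ∫⁻ x, ENNReal.ofReal (f x) ∂μ ≠ ∞ := hf.lintegral_lt_top.ne
  have h2 : ∫⁻ x, ENNReal.ofReal (-f x) ∂μ ≠ ∞ := hf.neg.lintegral_lt_top.ne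
  have m1 := (measurable_condLExp' m μ (fun y => ENNReal.ofReal (f y))).aemeasurable (μ := μ)
  have m2 := (measurable_condLExp' m μ (fun y => ENNReal.ofReal (-f y))).aemeasurable (μ := μ)
  rw [← lintegral_condLExp hm] at h1 h2
  have i1 := integrable_toReal_of_lintegral_ne_top m1 h1
  have i2 := integrable_toReal_of_lintegral_ne_top m2 h2
  refine ⟨i1.sub i2, ?_⟩
  rw [integral_eq_lintegral_pos_part_sub_lintegral_neg_part hf]
  simp only [condR]
  rw [integral_sub i1 i2, integral_toReal m1 (ae_lt_top' m1 h1), integral_toReal m2 (ae_lt_top' m2 h2),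
    lintegral_condLExp hm, lintegral_condLExp hm]

theorem integral_condC (hm : m ≤ m0) [SigmaFinite (μ.trim hm)] {f : X → ℂ}
    (hf : Integrable f μ) : ∫ x, condC m μ f x ∂μ = ∫ x, f x ∂μ := by
  obtain ⟨i1, e1⟩ := integral_condR hm hf.re
  obtain ⟨i2, e2⟩ := integral_condR hm hf.im
  simp only [RCLike.re_eq_complex_re, RCLike.im_eq_complex_im] at *
  have h := integral_re_add_im (𝕜 := ℂ) hf
  simp only [RCLike.re_eq_complex_re, RCLike.im_eq_complex_im] at h
  have i3 : Integrable (condC m μ f) μ := by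
    have : condC m μ f = fun x => ((condR m μ (fun y => (f y).re) x : ℝ) : ℂ)
        + ((condR m μ (fun y => (f y).im) x : ℝ) : ℂ) * Complex.I := by
      ext x; simp [condC, Complex.ext_iff]
    rw [this]
    exact i1.ofReal.add (i2.ofReal.mul_const _)
  have h' := integral_re_add_im (𝕜 := ℂ) i3
  simp only [RCLike.re_eq_complex_re, RCLike.im_eq_complex_im] at h'
  rw [← h, ← h', ← e1, ← e2]
  rfl

theorem condSq_conj (u : X → ℂ) : condSq m μ (fun y => conj (u y)) = condSq m μ u := by
  simp only [condSq]
  congr 1 with y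
  rw [← ofReal_norm, ← ofReal_norm, RCLike.norm_conj]

theorem condC_conj_mul_mul (hm : m ≤ m0) [SigmaFinite (μ.trim hm)] {v c : X → ℂ}
    (hv : AEMeasurable v μ) (hB : ∀ᵐ x ∂μ, condSq m μ v x < ∞) (hc : Measurable[m] c) :
    Conditionable m μ (fun y => conj (v y) * (v y * c y)) ∧
    condC m μ (fun y => conj (v y) * (v y * c y)) =ᵐ[μ]
      fun x => ((condSq m μ v x).toReal : ℂ) * c x := by
  have e : (fun y => conj (v y) * (v y * c y)) = fun y => c y * ((‖v y‖ₑ ^ 2).toReal : ℂ) := by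
    ext y
    rw [← mul_assoc, mul_comm (conj _), Complex.mul_conj, Complex.normSq_eq_norm_sq]
    simp [mul_comm]
  have hf : Conditionable m μ (fun y => ((‖v y‖ₑ ^ 2).toReal : ℂ)) := by
    refine ⟨?_, ?_⟩
    · exact Complex.measurable_ofReal.comp_aemeasurable (hv.enorm.pow_const 2).ennreal_toReal
    · filter_upwards [hB] with x hx
      have : (fun y => ‖((‖v y‖ₑ ^ 2).toReal : ℂ)‖ₑ) = fun y => ‖v y‖ₑ ^ 2 := by
        ext y
        rw [← ofReal_norm, Complex.norm_real, Real.norm_eq_abs,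
          abs_of_nonneg ENNReal.toReal_nonneg, ENNReal.ofReal_toReal (by finiteness)]
      rw [this]; exact hx
  rw [e]
  refine ⟨hf.mul hm hc, ?_⟩
  filter_upwards [condC_mul hm hc hf] with x hx
  rw [hx, condC_ofReal_toReal (by finiteness), mul_comm]
  rfl

/-- Turns membership of `vc` in `L²` into an integrability condition on `m`-measurable functions. -/
theorem lintegral_enorm_mul_sq (hm : m ≤ m0) [SigmaFinite (μ.trim hm)] {v c : X → ℂ}
    (hv : AEMeasurable v μ) (hc : Measurable[m] c) :
    ∫⁻ x, ‖v x * c x‖ₑ ^ 2 ∂μ = ∫⁻ x, condSq m μ v x * ‖c x‖ₑ ^ 2 ∂μ := by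
  have mc : Measurable[m] fun x => ‖c x‖ₑ ^ 2 := (measurable_enorm.comp hc).pow_const 2
  have h := condLExp_mul_left hm (μ := μ) mc (hv.enorm.pow_const 2)
  simp only [enorm_mul, mul_pow]
  simp only [mul_comm (‖v _‖ₑ ^ 2)]
  rw [← lintegral_condLExp hm, lintegral_congr_ae h]
  simp only [mul_comm, condSq]

end CondC
end WCT

/-- The kernel is the slice of the graph at second coordinate `0`. -/
theorem LinearPMap.IsClosed.isClosed_pmapKer {H₁ H₂ : Type*}
    [NormedAddCommGroup H₁] [InnerProductSpace ℂ H₁] 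
    [NormedAddCommGroup H₂] [InnerProductSpace ℂ H₂] 
    {T : H₁ →ₗ.[ℂ] H₂} (hT : T.IsClosed) : _root_.IsClosed (pmapKer T : Set H₁) := by
  have e : (pmapKer T : Set H₁) = (fun x => (x, (0 : H₂))) ⁻¹' (T.graph : Set (H₁ × H₂)) := by
    ext x
    simp only [pmapKer, Submodule.map_coe, Submodule.coe_subtype, Set.mem_image, SetLike.mem_coe,
      LinearMap.mem_ker, Set.mem_preimage, LinearPMap.mem_graph_iff]
    exact exists_congr fun _ => and_comm
  rw [e]
  exact hT.preimage (by fun_prop)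

/-! ### Closedness of the operator when `E(|u|²)` is finite. -/

namespace WCT

section Closed

variable {X : Type*} {m : MeasurableSpace X} {m0 : MeasurableSpace X} {μ : Measure[m0] X}

theorem tendsto_zero_of_sq {r : ℕ → ℝ≥0∞} (h : Tendsto (fun n => r n ^ 2) atTop (𝓝 0)) :
    Tendsto r atTop (𝓝 0) := by
  have h' := ((ENNReal.continuous_rpow_const (y := 1 / 2)).tendsto 0).comp h
  rw [ENNReal.zero_rpow_of_pos (by norm_num)] at h'
  refine h'.congr fun n => ?_
  rw [Function.comp_apply, ← ENNReal.rpow_natCast, ← ENNReal.rpow_mul]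
  norm_num

theorem coeFn_wct {w u : X → ℂ} (f : (wct m μ w u).domain) :
    (wct m μ w u f : X → ℂ) =ᵐ[μ] wctFun m μ w u (f : Lp ℂ 2 μ) :=
  MemLp.coeFn_toLp f.2.2

theorem lintegral_enorm_sq (f : Lp ℂ 2 μ) : ∫⁻ x, ‖f x‖ₑ ^ 2 ∂μ = ‖f‖ₑ ^ 2 := by
  rw [Lp.enorm_def, eLpNorm_eq_lintegral_rpow_enorm_toReal (by norm_num) (by norm_num),
    ← ENNReal.rpow_natCast, ← ENNReal.rpow_mul]
  norm_num

theorem ae_tendsto_zero_of_lintegral_le {F : ℕ → X → ℝ≥0∞} (hF : ∀ n, AEMeasurable (F n) μ)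
    (h : ∀ n, ∫⁻ x, F n x ∂μ ≤ (1 / 2) ^ n) : ∀ᵐ x ∂μ, Tendsto (fun n => F n x) atTop (𝓝 0) := by
  have h1 : ∫⁻ x, ∑' n, F n x ∂μ ≠ ∞ := by
    rw [lintegral_tsum hF]
    refine ne_top_of_le_ne_top ?_ (ENNReal.tsum_le_tsum h)
    rw [ENNReal.tsum_geometric]
    simp
  filter_upwards [ae_lt_top' (AEMeasurable.tsum hF) h1] with x hx
  exact ENNReal.tendsto_atTop_zero_of_tsum_ne_top hx.ne

/-- Errors with squared norm at most `2⁻ⁿ` are summable, and `E` preserves integrals, so the series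
of `E(|aₙ - a₀|²)` converges a.e. -/
theorem exists_subseq_tendsto (hm : m ≤ m0) [SigmaFinite (μ.trim hm)] {a b : ℕ → Lp ℂ 2 μ}
    {a₀ b₀ : Lp ℂ 2 μ} (ha : Tendsto a atTop (𝓝 a₀)) (hb : Tendsto b atTop (𝓝 b₀)) :
    ∃ φ : ℕ → ℕ, (∀ᵐ x ∂μ, Tendsto (fun n => condSq m μ (a (φ n) - a₀ : Lp ℂ 2 μ) x) atTop (𝓝 0)) ∧
      ∀ᵐ x ∂μ, Tendsto (fun n => b (φ n) x) atTop (𝓝 (b₀ x)) := by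
  have key {c : ℕ → Lp ℂ 2 μ} {c₀ : Lp ℂ 2 μ} (hc : Tendsto c atTop (𝓝 c₀)) (n : ℕ) :
      ∀ᶠ k in atTop, ‖c k - c₀‖ₑ ^ 2 ≤ (1 / 2) ^ n := by
    have h : Tendsto (fun k => ‖c k - c₀‖ₑ ^ 2) atTop (𝓝 (‖(0 : Lp ℂ 2 μ)‖ₑ ^ 2)) := by
      refine (ENNReal.continuous_pow 2).tendsto _ |>.comp ?_
      refine (continuous_enorm.tendsto _).comp ?_
      simpa using hc.sub_const c₀
    simp only [enorm_zero, ne_eq, OfNat.ofNat_ne_zero, not_false_eq_true, zero_pow] at h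
    exact h.eventually (Iic_mem_nhds (by simp [ENNReal.pow_pos]))
  -- `φ` need not be increasing: only the limits along it are used.
  choose φ hφ using fun n => ((key ha n).and (key hb n)).exists
  refine ⟨φ, ae_tendsto_zero_of_lintegral_le
    (fun n => (measurable_condLExp' m μ _).aemeasurable) (fun n => ?_), ?_⟩
  · rw [condSq, lintegral_condLExp hm, lintegral_enorm_sq]
    exact (hφ n).1
  · have h := ae_tendsto_zero_of_lintegral_le (μ := μ)
      (F := fun n x => ‖(b (φ n) - b₀ : Lp ℂ 2 μ) x‖ₑ ^ 2)
      (fun n => (Lp.aestronglyMeasurable _).enorm.pow_const 2)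
      (fun n => by rw [lintegral_enorm_sq]; exact (hφ n).2)
    filter_upwards [h, ae_all_iff.2 fun n => Lp.coeFn_sub (b (φ n)) b₀] with x hx hs
    simp only [hs, Pi.sub_apply] at hx
    rw [tendsto_iff_edist_tendsto_0]
    simp only [edist_eq_enorm_sub]
    exact tendsto_zero_of_sq hx

theorem Conditionable.mul_Lp {u : X → ℂ} (hu : AEMeasurable u μ)
    (hA : ∀ᵐ x ∂μ, condSq m μ u x < ∞) (f : Lp ℂ 2 μ) :
    Conditionable m μ (fun y => u y * f y) :=
  conditionable_mul hu (Lp.aestronglyMeasurable f).aemeasurable hA (condSq_lt_top (Lp.memLp f))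

theorem condC_mul_sub {u : X → ℂ} (hu : AEMeasurable u μ)
    (hA : ∀ᵐ x ∂μ, condSq m μ u x < ∞) (f g : Lp ℂ 2 μ) :
    condC m μ (fun y => u y * (f - g : Lp ℂ 2 μ) y) =ᵐ[μ]
      fun x => condC m μ (fun y => u y * f y) x - condC m μ (fun y => u y * g y) x := by
  have h : (fun y => u y * f y) =ᵐ[μ] fun y => u y * (f - g : Lp ℂ 2 μ) y + u y * g y := by
    filter_upwards [Lp.coeFn_sub f g] with x hx
    rw [hx, Pi.sub_apply]; ring
  filter_upwards [condC_congr (m := m) h,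
    condC_add (Conditionable.mul_Lp hu hA (f - g)) (Conditionable.mul_Lp hu hA g)] with x h1 h2
  rw [h1, h2]; ring

theorem isClosed_wct (hm : m ≤ m0) [SigmaFinite (μ.trim hm)] (w : X → ℂ) {u : X → ℂ}
    (hu : AEMeasurable u μ) (hA : ∀ᵐ x ∂μ, condSq m μ u x < ∞) : (wct m μ w u).IsClosed := by
  refine IsSeqClosed.isClosed ?_
  rintro s ⟨f, g⟩ hs hlim
  have hf : Tendsto (fun n => (s n).1) atTop (𝓝 f) := (continuous_fst.tendsto _).comp hlim
  have hg : Tendsto (fun n => (s n).2) atTop (𝓝 g) := (continuous_snd.tendsto _).comp hlim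
  obtain ⟨φ, h1, h2⟩ := exists_subseq_tendsto hm hf hg
  have hval (n) : (s n).2 =ᵐ[μ] wctFun m μ w u (s n).1 := by
    obtain ⟨y, hy1, hy2⟩ := (LinearPMap.mem_graph_iff _).1 (hs n)
    rw [← hy1, ← hy2]
    exact coeFn_wct y
  have hsub n := condC_mul_sub hu hA (s (φ n)).1 f
  have hbd n := enorm_condC_mul_sq_le hm hu
    (Lp.aestronglyMeasurable ((s (φ n)).1 - f)).aemeasurable hA (condSq_lt_top (Lp.memLp _))
  have key : wctFun m μ w u f =ᵐ[μ] g := by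
    filter_upwards [h1, h2, ae_all_iff.2 hval, ae_all_iff.2 hsub, ae_all_iff.2 hbd, hA]
      with x h1 h2 hval hsub hbd hA
    have t1 : Tendsto (fun n => condC m μ (fun y => u y * (s (φ n)).1 y) x) atTop
        (𝓝 (condC m μ (fun y => u y * f y) x)) := by
      rw [tendsto_iff_edist_tendsto_0]
      simp only [edist_eq_enorm_sub, ← hsub]
      have b0 : Tendsto (fun n => 16 * (condSq m μ u x * condSq m μ ((s (φ n)).1 - f : Lp ℂ 2 μ) x))
          atTop (𝓝 (16 * (condSq m μ u x * 0))) :=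
        ENNReal.Tendsto.const_mul (ENNReal.Tendsto.const_mul h1 (.inr hA.ne)) (.inr (by simp))
      rw [mul_zero, mul_zero] at b0
      have sq := tendsto_of_tendsto_of_tendsto_of_le_of_le tendsto_const_nhds b0
        (fun _ => zero_le) hbd
      exact tendsto_zero_of_sq sq
    have t2 := t1.const_mul (w x)
    refine tendsto_nhds_unique t2 (h2.congr fun n => ?_)
    rw [hval]; rfl
  have hmem : f ∈ (wct m μ w u).domain :=
    ⟨Conditionable.mul_Lp hu hA f, (memLp_congr_ae key).2 (Lp.memLp g)⟩
  refine (LinearPMap.mem_graph_iff _).2 ⟨⟨f, hmem⟩, rfl, ?_⟩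
  exact Lp.ext ((coeFn_wct ⟨f, hmem⟩).trans key)

end Closed
end WCT

/-! ### For closed operators, functions supported on `{E(|u|²) = ∞}` lie in the kernel. -/

namespace WCT

section Finite

variable {X : Type*} {m : MeasurableSpace X} {m0 : MeasurableSpace X} {μ : Measure[m0] X}

theorem mem_pmapKer_wct {w u : X → ℂ} {f : Lp ℂ 2 μ} :
    f ∈ pmapKer (wct m μ w u) ↔
      Conditionable m μ (fun y => u y * f y) ∧ wctFun m μ w u f =ᵐ[μ] 0 := by
  rw [pmapKer, Submodule.mem_map]
  constructor
  · rintro ⟨y, hy, rfl⟩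
    refine ⟨y.2.1, (coeFn_wct y).symm.trans ?_⟩
    have : wct m μ w u y = 0 := hy
    rw [this]
    exact Lp.coeFn_zero _ _ _
  · rintro ⟨h1, h2⟩
    have hf : f ∈ (wct m μ w u).domain :=
      ⟨h1, (memLp_congr_ae h2).2 MemLp.zero⟩
    refine ⟨⟨f, hf⟩, ?_, rfl⟩
    change wct m μ w u ⟨f, hf⟩ = 0
    exact Lp.ext ((coeFn_wct ⟨f, hf⟩).trans (h2.trans (Lp.coeFn_zero _ _ _).symm))

theorem tendsto_toLp {a : ℕ → X → ℂ} {a₀ : X → ℂ} (ha : ∀ n, MemLp (a n) 2 μ) (ha₀ : MemLp a₀ 2 μ)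
    (h : Tendsto (fun n => ∫⁻ x, ‖a n x - a₀ x‖ₑ ^ 2 ∂μ) atTop (𝓝 0)) :
    Tendsto (fun n => (ha n).toLp (a n)) atTop (𝓝 (ha₀.toLp a₀)) := by
  rw [tendsto_iff_edist_tendsto_0]
  refine tendsto_zero_of_sq (h.congr fun n => ?_)
  rw [edist_eq_enorm_sub, ← MemLp.toLp_sub, ← lintegral_enorm_sq]
  refine lintegral_congr_ae ?_
  filter_upwards [MemLp.coeFn_toLp ((ha n).sub ha₀)] with x hx
  rw [hx, Pi.sub_apply]

theorem condLExp_iSup (hm : m ≤ m0) [SigmaFinite (μ.trim hm)] {f : ℕ → X → ℝ≥0∞}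
    (hf : ∀ n, AEMeasurable (f n) μ) (hmono : ∀ x, Monotone fun n => f n x) :
    (fun x => ⨆ n, condLExp m μ (f n) x) =ᵐ[μ] condLExp m μ fun x => ⨆ n, f n x := by
  refine ae_eq_condLExp hm μ _ (Measurable.iSup fun n => measurable_condLExp m μ _) fun s hs => ?_
  have hE : ∀ᵐ x ∂μ, Monotone fun n => condLExp m μ (f n) x := by
    have : ∀ᵐ x ∂μ, ∀ n, condLExp m μ (f n) x ≤ condLExp m μ (f (n + 1)) x :=
      ae_all_iff.2 fun n => condLExp_mono (ae_of_all _ fun x => hmono x (Nat.le_succ n))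
    filter_upwards [this] with x hx using monotone_nat_of_le_succ hx
  rw [lintegral_iSup' (fun n => (measurable_condLExp' m μ _).aemeasurable)
      (ae_restrict_of_ae hE), lintegral_iSup' (fun n => (hf n).restrict) (ae_of_all _ hmono)]
  simp only [setLIntegral_condLExp hm μ _ hs]

/-- The truncation of `u` to the set where `‖u‖ ≤ n`. -/
noncomputable def trunc (u : X → ℂ) (n : ℕ) : X → ℂ := {x | ‖u x‖ₑ ≤ n}.indicator u

theorem measurable_trunc {u : X → ℂ} (hu : Measurable u) (n : ℕ) : Measurable (trunc u n) :=
  hu.indicator (measurableSet_le hu.enorm measurable_const)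

theorem enorm_trunc_le (u : X → ℂ) (n : ℕ) (x : X) : ‖trunc u n x‖ₑ ≤ n := by
  by_cases hx : ‖u x‖ₑ ≤ n
  · rwa [trunc, Set.indicator_of_mem (by exact hx)]
  · rw [trunc, Set.indicator_of_notMem (by exact hx)]; simp

theorem condSq_trunc_lt_top (hm : m ≤ m0) [SigmaFinite (μ.trim hm)] (u : X → ℂ) (n : ℕ) :
    ∀ᵐ x ∂μ, condSq m μ (trunc u n) x < ∞ := by
  have h := condLExp_mono (mΩ := m) (P := μ) (X := fun x => ‖trunc u n x‖ₑ ^ 2)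
    (Y := fun _ => (n : ℝ≥0∞) ^ 2) (ae_of_all _ fun x => by
      have := enorm_trunc_le u n x
      dsimp only
      gcongr)
  rw [condLExp_const hm] at h
  filter_upwards [h] with x hx
  exact hx.trans_lt (by simp)

theorem tendsto_condSq_trunc (hm : m ≤ m0) [SigmaFinite (μ.trim hm)] {u : X → ℂ} (hu : Measurable u) :
    ∀ᵐ x ∂μ, Tendsto (fun n => condSq m μ (trunc u n) x) atTop (𝓝 (condSq m μ u x)) := by
  have hmono (x) : Monotone fun n => ‖trunc u n x‖ₑ ^ 2 := by
    intro i j hij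
    dsimp only
    gcongr
    by_cases hx : ‖u x‖ₑ ≤ i
    · have hx' : ‖u x‖ₑ ≤ j := hx.trans (by exact_mod_cast hij)
      rw [trunc, trunc, Set.indicator_of_mem (by exact hx), Set.indicator_of_mem (by exact hx')]
    · rw [trunc, Set.indicator_of_notMem (by exact hx)]; simp
  have h := condLExp_iSup hm (μ := μ)
    (fun n => ((measurable_trunc hu n).enorm.pow_const 2).aemeasurable) hmono
  have e : (fun x => ⨆ n, ‖trunc u n x‖ₑ ^ 2) = fun x => ‖u x‖ₑ ^ 2 := by
    ext x
    apply le_antisymm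
    · refine iSup_le fun n => ?_
      gcongr
      exact enorm_indicator_le_enorm_self _ _
    · obtain ⟨n, hn⟩ := ENNReal.exists_nat_gt (enorm_ne_top (x := u x))
      refine le_iSup_of_le n ?_
      rw [trunc, Set.indicator_of_mem (by exact hn.le)]
  rw [e] at h
  have : ∀ᵐ x ∂μ, ∀ n, condSq m μ (trunc u n) x ≤ condSq m μ (trunc u (n + 1)) x :=
    ae_all_iff.2 fun n => condLExp_mono (ae_of_all _ fun x => hmono x (Nat.le_succ n))
  filter_upwards [h, this] with x hx hx'
  rw [condSq, ← hx]
  exact tendsto_atTop_iSup (monotone_nat_of_le_succ hx')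

theorem mul_conj_trunc (u : X → ℂ) (n : ℕ) (x : X) :
    u x * conj (trunc u n x) = trunc u n x * conj (trunc u n x) := by
  by_cases hx : ‖u x‖ₑ ≤ n
  · rw [trunc, Set.indicator_of_mem (by exact hx)]
  · rw [trunc, Set.indicator_of_notMem (by exact hx)]; simp

theorem condC_mul_conj_trunc (hm : m ≤ m0) [SigmaFinite (μ.trim hm)] {u c : X → ℂ}
    (hu : Measurable u) (n : ℕ) (hc : Measurable[m] c) :
    Conditionable m μ (fun y => u y * (conj (trunc u n y) * c y)) ∧
    condC m μ (fun y => u y * (conj (trunc u n y) * c y)) =ᵐ[μ]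
      fun x => ((condSq m μ (trunc u n) x).toReal : ℂ) * c x := by
  have h := condC_conj_mul_mul hm (μ := μ) (v := fun y => conj (trunc u n y)) (c := c)
    (Complex.continuous_conj.measurable.comp (measurable_trunc hu n)).aemeasurable
    (by rw [condSq_conj]; exact condSq_trunc_lt_top hm u n) hc
  simp only [condSq_conj, Complex.conj_conj] at h
  simpa only [← mul_assoc, mul_conj_trunc] using h

/-- If `M_w E M_u` is closed, its kernel contains every `L²` function supported
where `E(|u|²) = ∞` and `u` is bounded. -/
theorem mem_pmapKer_of_trunc (hm : m ≤ m0) [SigmaFinite (μ.trim hm)] {w u : X → ℂ}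
    (hu : Measurable u) (hT : (wct m μ w u).IsClosed) {g : X → ℂ} (hg : MemLp g 2 μ)
    (hgG : ∀ x, condSq m μ u x ≠ ∞ → g x = 0) {k : ℕ} (hgk : ∀ x, ¬ ‖u x‖ₑ ≤ k → g x = 0) :
    hg.toLp g ∈ pmapKer (wct m μ w u) := by
  set e : ℕ → X → ℝ≥0∞ := fun n => condSq m μ (trunc u n) with he
  have me n : Measurable[m] (e n) := measurable_condLExp m μ _
  have met n := condSq_trunc_lt_top (μ := μ) hm u n
  have mg : AEMeasurable g μ := hg.1.aemeasurable
  -- The bound `1 ≤ eₙ` makes division by `eₙ` harmless and provides the dominating function; `F n`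
  -- fills `{E(|u|²) = ∞}` because `eₙ → ∞` there.
  set F : ℕ → Set X := fun n => {x | condSq m μ u x = ∞ ∧ 1 ≤ e n x} with hF
  have mF n : MeasurableSet[m] (F n) :=
    (measurable_condLExp m μ _ (measurableSet_singleton ∞)).inter ((me n) measurableSet_Ici)
  have hug : MemLp (fun y => u y * g y) 2 μ := by
    refine MemLp.of_le_mul (g := g) (c := k) hg (hu.aemeasurable.mul mg).aestronglyMeasurable ?_
    refine ae_of_all _ fun x => ?_
    by_cases hx : ‖u x‖ₑ ≤ k
    · rw [norm_mul]
      gcongr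
      rw [← ofReal_norm] at hx
      simpa using ENNReal.toReal_mono (by simp) hx
    · simp [hgk x hx]
  have one_fin : ∀ᵐ x ∂μ, condSq m μ (fun _ : X => (1 : ℂ)) x = 1 := by
    rw [condSq]; simp [condLExp_const hm]
  have hcond : Conditionable m μ (fun y => u y * g y) := by
    have := conditionable_mul (m := m) (u := fun _ => (1 : ℂ)) aemeasurable_const hug.1.aemeasurable
      (one_fin.mono fun x hx => by rw [hx]; simp) (condSq_lt_top hug)
    simpa using this
  set ε : X → ℂ := condC m μ (fun y => u y * g y) with hε
  have mε : Measurable[m] ε := measurable_condC _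
  -- `E` maps `L²` to `L²`: conditional Cauchy–Schwarz with first factor `1`.
  have hεL : ∫⁻ x, ‖ε x‖ₑ ^ 2 ∂μ ≠ ∞ := by
    have h := enorm_condC_mul_sq_le hm (μ := μ) (u := fun _ => (1 : ℂ)) aemeasurable_const
      hug.1.aemeasurable (one_fin.mono fun x hx => by rw [hx]; simp) (condSq_lt_top hug)
    simp only [one_mul] at h
    refine ne_top_of_le_ne_top ?_ (lintegral_mono_ae (g := fun x => 16 * condSq m μ (fun y => u y * g y) x) ?_)
    · rw [condSq, lintegral_const_mul _ (measurable_condLExp' m μ _), lintegral_condLExp hm]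
      exact ENNReal.mul_ne_top (by simp) (lintegral_enorm_sq_lt_top hug).ne
    · filter_upwards [h, one_fin] with x h h1
      rwa [h1, one_mul] at h
  -- With `bₙ = conj(uₙ) cₙ`, where `uₙ` is the truncation, `E(u bₙ) = eₙ cₙ = χ_{Fₙ} E(ug)`. Hence
  -- `χ_{Fₙ} g - bₙ` is in the kernel.
  set c : ℕ → X → ℂ := fun n => (F n).indicator fun x => ε x / ((e n x).toReal : ℂ) with hc
  have mc n : Measurable[m] (c n) :=
    (mε.div (Complex.measurable_ofReal.comp (me n).ennreal_toReal)).indicator (mF n)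
  set b : ℕ → X → ℂ := fun n x => conj (trunc u n x) * c n x with hb
  have mtr n : AEMeasurable (fun x => conj (trunc u n x)) μ :=
    (Complex.continuous_conj.measurable.comp (measurable_trunc hu n)).aemeasurable
  have mb n : AEMeasurable (b n) μ := (mtr n).mul ((mc n).mono hm le_rfl).aemeasurable
  have ib n : ∫⁻ x, ‖b n x‖ₑ ^ 2 ∂μ = ∫⁻ x, e n x * ‖c n x‖ₑ ^ 2 ∂μ := by
    have := lintegral_enorm_mul_sq hm (μ := μ) (mtr n) (mc n)
    rw [condSq_conj] at this
    exact this
  have ec n : ∀ᵐ x ∂μ, e n x * ‖c n x‖ₑ ^ 2 = (F n).indicator (fun x => ‖ε x‖ₑ ^ 2 * (e n x)⁻¹) x := by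
    filter_upwards [met n] with x hx
    by_cases hxF : x ∈ F n
    · have h1 : e n x ≠ 0 := (zero_lt_one.trans_le hxF.2).ne'
      have h2 : (e n x).toReal ≠ 0 := (ENNReal.toReal_pos h1 hx.ne).ne'
      have h3 : ‖((e n x).toReal : ℂ)‖ₑ = e n x := by
        rw [← ofReal_norm, Complex.norm_real, Real.norm_eq_abs, abs_of_nonneg ENNReal.toReal_nonneg,
          ENNReal.ofReal_toReal hx.ne]
      simp only [hc, Set.indicator_of_mem hxF]
      rw [div_eq_mul_inv, enorm_mul, enorm_inv (by exact_mod_cast h2), h3, mul_pow]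
      rw [show e n x * (‖ε x‖ₑ ^ 2 * (e n x)⁻¹ ^ 2) = ‖ε x‖ₑ ^ 2 * (e n x)⁻¹ * (e n x * (e n x)⁻¹) by ring,
        ENNReal.mul_inv_cancel h1 hx.ne, mul_one]
    · simp [hc, Set.indicator_of_notMem hxF]
  have bd n : ∀ᵐ x ∂μ, e n x * ‖c n x‖ₑ ^ 2 ≤ ‖ε x‖ₑ ^ 2 := by
    filter_upwards [ec n] with x hx
    rw [hx]
    by_cases hxF : x ∈ F n
    · rw [Set.indicator_of_mem hxF]
      exact mul_le_of_le_one_right' (ENNReal.inv_le_one.2 hxF.2)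
    · simp [Set.indicator_of_notMem hxF]
  have Lb n : MemLp (b n) 2 μ := by
    rw [memLp_two_iff (mb n), ib]
    exact (lintegral_mono_ae (bd n)).trans_lt hεL.lt_top
  have La n : MemLp ((F n).indicator g) 2 μ := hg.indicator (hm _ (mF n))
  have hker n : (La n).toLp _ - (Lb n).toLp _ ∈ pmapKer (wct m μ w u) := by
    rw [← MemLp.toLp_sub]
    have h1 : (fun y => u y * ((F n).indicator g y)) = (F n).indicator fun y => u y * g y := by
      ext y; by_cases hy : y ∈ F n <;> simp [hy]
    have h2 := condC_mul_conj_trunc (μ := μ) hm hu n (mc n)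
    have c1 : Conditionable m μ (fun y => u y * ((F n).indicator g y)) := by
      have := hcond.mul hm (a := (F n).indicator fun _ => (1 : ℂ)) (measurable_const.indicator (mF n))
      refine this.congr (ae_of_all _ fun y => ?_)
      by_cases hy : y ∈ F n <;> simp [hy]
    have c2 := h2.1.const_mul (-1)
    have ev : (fun y => u y * ((F n).indicator g y) + -1 * (u y * (conj (trunc u n y) * c n y)))
        =ᵐ[μ] fun y => u y * ((La n).sub (Lb n)).toLp _ y := by
      filter_upwards [MemLp.coeFn_toLp ((La n).sub (Lb n))] with x hx
      rw [hx, Pi.sub_apply]; ring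
    refine mem_pmapKer_wct.2 ⟨(c1.add c2).congr ev, ?_⟩
    filter_upwards [condC_congr (m := m) ev, condC_add c1 c2, condC_const_mul h2.1 (-1), h2.2,
      condC_indicator hm (mF n) (hu.aemeasurable.mul mg), met n] with x e1 e2 e3 e4 e5 hx
    have : condC m μ (fun y => u y * ((F n).indicator g y)) x = (F n).indicator ε x := by
      rw [h1]; exact e5
    simp only [wctFun, Pi.zero_apply]
    rw [← e1, e2, e3, e4, this]
    by_cases hxF : x ∈ F n
    · have h1 : e n x ≠ 0 := (zero_lt_one.trans_le hxF.2).ne'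
      have h2 : ((e n x).toReal : ℂ) ≠ 0 := by exact_mod_cast (ENNReal.toReal_pos h1 hx.ne).ne'
      simp only [hc, Set.indicator_of_mem hxF]
      change w x * (ε x + -1 * (((e n x).toReal : ℂ) * (ε x / ((e n x).toReal : ℂ)))) = 0
      field_simp
      simp
    · simp [hc, Set.indicator_of_notMem hxF]
  have limA : Tendsto (fun n => (La n).toLp _) atTop (𝓝 (hg.toLp g)) := by
    refine tendsto_toLp La hg ?_
    have := tendsto_lintegral_of_dominated_convergence' (μ := μ) (f := fun _ => 0)
      (F := fun n x => ‖(F n).indicator g x - g x‖ₑ ^ 2)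
      (fun x => ‖g x‖ₑ ^ 2) (fun n => (((mg.indicator (hm _ (mF n))).sub mg).enorm.pow_const 2))
      (fun n => ae_of_all _ fun x => by
        by_cases hxF : x ∈ F n <;> simp [hxF])
      (lintegral_enorm_sq_lt_top hg).ne (by
        filter_upwards [tendsto_condSq_trunc (μ := μ) hm hu] with x hx
        by_cases hxG : condSq m μ u x = ∞
        · rw [hxG] at hx
          refine tendsto_const_nhds.congr' ?_
          filter_upwards [hx.eventually (lt_mem_nhds ENNReal.one_lt_top)] with n hn
          have : x ∈ F n := ⟨hxG, hn.le⟩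
          simp [this]
        · have e0 := hgG x hxG
          refine tendsto_const_nhds.congr fun n => ?_
          by_cases hxF : x ∈ F n <;> simp [hxF, e0])
    simpa using this
  -- The squared norm of `bₙ` is the integral of `|ε|²/eₙ` over `F n`; it tends to `0` since `eₙ →
  -- ∞`, with dominating function `|ε|²`.
  have limB : Tendsto (fun n => (Lb n).toLp _) atTop (𝓝 0) := by
    have : Tendsto (fun n => (Lb n).toLp _) atTop (𝓝 ((MemLp.zero (ε := ℂ)).toLp 0)) := by
      refine tendsto_toLp Lb MemLp.zero ?_
      simp only [Pi.zero_apply, sub_zero, ib]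
      have := tendsto_lintegral_of_dominated_convergence' (μ := μ) (f := fun _ => 0)
        (F := fun n x => e n x * ‖c n x‖ₑ ^ 2)
        (fun x => ‖ε x‖ₑ ^ 2) (fun n => ((me n).mono hm le_rfl).aemeasurable.mul
          (((mc n).mono hm le_rfl).enorm.pow_const 2).aemeasurable) bd hεL (by
          filter_upwards [tendsto_condSq_trunc (μ := μ) hm hu, ae_all_iff.2 ec] with x hx hec
          simp only [hec]
          by_cases hxG : condSq m μ u x = ∞
          · rw [hxG] at hx
            have l : Tendsto (fun n => ‖ε x‖ₑ ^ 2 * (e n x)⁻¹) atTop (𝓝 (‖ε x‖ₑ ^ 2 * 0)) :=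
              ENNReal.Tendsto.const_mul (by simpa using tendsto_inv_iff.2 hx) (.inr (by finiteness))
            rw [mul_zero] at l
            exact tendsto_of_tendsto_of_tendsto_of_le_of_le tendsto_const_nhds l
              (fun _ => zero_le) (fun n => Set.indicator_le_self _ _ x)
          · refine tendsto_const_nhds.congr fun n => ?_
            rw [Set.indicator_of_notMem fun h => hxG h.1])
      simpa using this
    simpa using this
  have hlim := limA.sub limB
  rw [sub_zero] at hlim
  exact hT.isClosed_pmapKer.mem_of_tendsto hlim (Eventually.of_forall hker)

/-- Cutting `g` to `{|u| ≤ k}` gives kernel elements converging to `g`. The consequence used later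
is that `ug` is conditionable. -/
theorem mem_pmapKer_of_condSq_eq_top (hm : m ≤ m0) [SigmaFinite (μ.trim hm)] {w u : X → ℂ}
    (hu : Measurable u) (hT : (wct m μ w u).IsClosed) {g : X → ℂ} (hg : MemLp g 2 μ)
    (hgG : ∀ x, condSq m μ u x ≠ ∞ → g x = 0) : hg.toLp g ∈ pmapKer (wct m μ w u) := by
  have mK (k : ℕ) : MeasurableSet {x | ‖u x‖ₑ ≤ k} := measurableSet_le hu.enorm measurable_const
  have La k : MemLp ({x | ‖u x‖ₑ ≤ (k : ℕ)}.indicator g) 2 μ := hg.indicator (mK k)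
  have mg := hg.1.aemeasurable
  have limA : Tendsto (fun n => (La n).toLp _) atTop (𝓝 (hg.toLp g)) := by
    refine tendsto_toLp La hg ?_
    have := tendsto_lintegral_of_dominated_convergence' (μ := μ) (f := fun _ => 0)
      (F := fun n x => ‖{x | ‖u x‖ₑ ≤ (n : ℕ)}.indicator g x - g x‖ₑ ^ 2)
      (fun x => ‖g x‖ₑ ^ 2) (fun n => (((mg.indicator (mK n)).sub mg).enorm.pow_const 2))
      (fun n => ae_of_all _ fun x => by
        by_cases hxF : ‖u x‖ₑ ≤ n <;> simp [hxF])
      (lintegral_enorm_sq_lt_top hg).ne (ae_of_all _ fun x => by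
        refine tendsto_const_nhds.congr' ?_
        obtain ⟨k, hk⟩ := ENNReal.exists_nat_gt (enorm_ne_top (x := u x))
        filter_upwards [eventually_ge_atTop k] with n hn
        have : ‖u x‖ₑ ≤ n := hk.le.trans (by exact_mod_cast hn)
        simp [this])
    simpa using this
  refine hT.isClosed_pmapKer.mem_of_tendsto limA (Eventually.of_forall fun k => ?_)
  refine mem_pmapKer_of_trunc hm hu hT (La k) (fun x hx => ?_) (k := k) (fun x hx => ?_)
  · by_cases hxF : ‖u x‖ₑ ≤ k <;> simp [hxF, hgG x hx]
  · simp [hx]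

end Finite
end WCT

/-! ### Finiteness of `E(|u|²)` for closed operators. -/

namespace WCT

section Finite

variable {X : Type*} {m : MeasurableSpace X} {m0 : MeasurableSpace X} {μ : Measure[m0] X}

/-- A lacunary construction. With `ψₖ = χ_{Fₖ} |uₖ| / E(|uₖ|²)` for truncations `uₖ` of `u`, one has
`E(|uₖ| ψₖ) = 1` on `Fₖ`, while `E(ψₖ²) = 1/E(|uₖ|²) ≤ 16⁻ᵏ` there. For `h² = Σ 4ᵏ ψₖ²` this gives
`h ∈ L²` and `E(|uh|) ≥ 2ᵏ` on every `Fₖ`, so `E(|uh|) = ∞` on their intersection. -/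
theorem exists_condLExp_enorm_mul_eq_top (hm : m ≤ m0) [SigmaFinite (μ.trim hm)] {u : X → ℂ}
    (hu : Measurable u) {G : Set X} (mG : MeasurableSet[m] G) (hG : ∀ x ∈ G, condSq m μ u x = ∞)
    (hG0 : μ G ≠ 0) (hGfin : μ G ≠ ∞) :
    ∃ h : X → ℂ, MemLp h 2 μ ∧ (∀ x ∉ G, h x = 0) ∧
      ¬ ∀ᵐ x ∂μ, condLExp m μ (fun y => ‖u y * h y‖ₑ) x < ∞ := by
  have met := fun n => condSq_trunc_lt_top (μ := μ) hm u n
  have me n : Measurable[m] (condSq m μ (trunc u n)) := measurable_condLExp m μ _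
  have lim := tendsto_condSq_trunc (μ := μ) hm hu
  -- Since `μ G < ∞`, the a.e. divergence of `E(|uₙ|²)` on `G` makes these exceptional sets small in
  -- measure.
  have choice (k : ℕ) {ε : ℝ≥0∞} (hε : 0 < ε) :
      ∃ n, μ {x ∈ G | condSq m μ (trunc u n) x < 16 ^ k} ≤ ε := by
    have ms n : MeasurableSet[m] {x | condSq m μ (trunc u n) x < 16 ^ k} := (me n) measurableSet_Iio
    have h := tendsto_lintegral_of_dominated_convergence' (μ := μ) (f := fun _ => 0)
      (F := fun n => (G ∩ {x | condSq m μ (trunc u n) x < 16 ^ k}).indicator 1)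
      (G.indicator 1) (fun n => (measurable_one.indicator (hm _ (mG.inter (ms n)))).aemeasurable)
      (fun n => ae_of_all _ fun x => Set.indicator_le_indicator_of_subset Set.inter_subset_left
        (fun _ => zero_le) x)
      (by rwa [lintegral_indicator_one (hm _ mG)]) (by
        filter_upwards [lim] with x hx
        by_cases hxG : x ∈ G
        · rw [hG x hxG] at hx
          refine tendsto_const_nhds.congr' ?_
          filter_upwards [hx.eventually (lt_mem_nhds (show (16 : ℝ≥0∞) ^ k < ∞ by finiteness))]
            with n hn
          rw [Set.indicator_of_notMem]
          exact fun h => lt_asymm h.2 hn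
        · simp [hxG])
    rw [lintegral_zero] at h
    simp only [lintegral_indicator_one (hm _ (mG.inter (ms _)))] at h
    obtain ⟨n, hn⟩ := (h.eventually (Iic_mem_nhds hε)).exists
    exact ⟨n, hn⟩
  -- A total exceptional measure below `μ G` leaves a set of positive measure lying in all the `F
  -- k`.
  obtain ⟨δ, δpos, δsum⟩ := ENNReal.exists_pos_sum_of_countable' hG0 ℕ
  choose ν hν using fun k => choice k (δpos k)
  set e : ℕ → X → ℝ≥0∞ := fun k => condSq m μ (trunc u (ν k)) with he
  set F : ℕ → Set X := fun k => G ∩ {x | 16 ^ k ≤ e k x} with hF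
  have mF k : MeasurableSet[m] (F k) := mG.inter ((me (ν k)) measurableSet_Ici)
  set c : ℕ → X → ℝ≥0∞ := fun k => (F k).indicator fun x => (e k x)⁻¹ with hc
  have mc k : Measurable[m] (c k) := ((me (ν k)).inv).indicator (mF k)
  set ψ : ℕ → X → ℝ≥0∞ := fun k x => c k x * ‖trunc u (ν k) x‖ₑ with hψ
  have mψ k : Measurable (ψ k) := ((mc k).mono hm le_rfl).mul (measurable_trunc hu _).enorm
  set H : X → ℝ≥0∞ := fun x => ∑' k, 4 ^ k * ψ k x ^ 2 with hH
  have mH : Measurable H := Measurable.tsum fun k => ((mψ k).pow_const 2).const_mul _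
  have ec k : ∀ᵐ x ∂μ, c k x * e k x = (F k).indicator 1 x := by
    filter_upwards [met (ν k)] with x hx
    by_cases hxF : x ∈ F k
    · have : e k x ≠ 0 := (lt_of_lt_of_le (by positivity) hxF.2).ne'
      simp [hc, hxF, ENNReal.inv_mul_cancel this hx.ne]
    · simp [hc, hxF]
  have intψ k : ∫⁻ x, 4 ^ k * ψ k x ^ 2 ∂μ ≤ (1 / 4) ^ k * μ G := by
    have h1 : ∫⁻ x, ψ k x ^ 2 ∂μ ≤ ∫⁻ x, G.indicator (fun _ => (1 / 16) ^ k) x ∂μ := by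
      have h := condLExp_mul_left hm (μ := μ) ((mc k).pow_const 2)
        ((measurable_trunc hu (ν k)).enorm.pow_const 2).aemeasurable
      simp only [hψ, mul_pow]
      rw [← lintegral_condLExp hm, lintegral_congr_ae h]
      refine lintegral_mono_ae ?_
      filter_upwards [ec k] with x hx
      change c k x ^ 2 * e k x ≤ _
      rw [pow_two, mul_assoc, hx]
      by_cases hxF : x ∈ F k
      · rw [Set.indicator_of_mem hxF, Set.indicator_of_mem hxF.1, Pi.one_apply, mul_one]
        simp only [hc, Set.indicator_of_mem hxF]
        rw [one_div, ← ENNReal.inv_pow]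
        exact ENNReal.inv_le_inv.2 hxF.2
      · simp [hxF]
    rw [lintegral_const_mul _ ((mψ k).pow_const 2)]
    rw [lintegral_indicator_const (hm _ mG)] at h1
    refine (mul_le_mul_right h1 _).trans ?_
    rw [← mul_assoc, ← mul_pow]
    gcongr
    rw [show (16 : ℝ≥0∞) = 4 * 4 by norm_num, one_div, one_div, ENNReal.mul_inv (by simp) (by simp),
      ← mul_assoc, ENNReal.mul_inv_cancel (by simp) (by simp), one_mul]
  have intH : ∫⁻ x, H x ∂μ < ∞ := by
    rw [lintegral_tsum fun k => (((mψ k).pow_const 2).const_mul _).aemeasurable]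
    refine (ENNReal.tsum_le_tsum intψ).trans_lt ?_
    rw [ENNReal.tsum_mul_right, ENNReal.tsum_geometric]
    refine ENNReal.mul_lt_top ?_ hGfin.lt_top
    rw [ENNReal.inv_lt_top, tsub_pos_iff_lt]
    simp [ENNReal.inv_lt_one]
  have Hfin : ∀ᵐ x ∂μ, H x < ∞ := ae_lt_top mH intH.ne
  set h : X → ℂ := fun x => ((H x ^ (1 / 2 : ℝ)).toReal : ℂ) with hh
  have mh : Measurable h := Complex.measurable_ofReal.comp (mH.pow_const _).ennreal_toReal
  have enh : ∀ᵐ x ∂μ, ‖h x‖ₑ = H x ^ (1 / 2 : ℝ) := by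
    filter_upwards [Hfin] with x hx
    rw [← ofReal_norm, Complex.norm_real, Real.norm_eq_abs, abs_of_nonneg ENNReal.toReal_nonneg,
      ENNReal.ofReal_toReal (ENNReal.rpow_ne_top_of_nonneg (by norm_num) hx.ne)]
  have enh2 : ∀ᵐ x ∂μ, ‖h x‖ₑ ^ 2 = H x := by
    filter_upwards [enh] with x hx
    rw [hx, ← ENNReal.rpow_natCast, ← ENNReal.rpow_mul]
    norm_num
  refine ⟨h, ?_, fun x hx => ?_, fun hcon => ?_⟩
  · rw [memLp_two_iff mh.aemeasurable, lintegral_congr_ae enh2]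
    exact intH
  · have : H x = 0 := by
      simp only [hH, ENNReal.tsum_eq_zero]
      intro k
      have : x ∉ F k := fun h => hx h.1
      simp [hψ, hc, this]
    simp [hh, this]
  · have low k : ∀ᵐ x ∂μ, x ∈ F k → 2 ^ k ≤ condLExp m μ (fun y => ‖u y * h y‖ₑ) x := by
      have h1 := condLExp_mul_left hm (μ := μ) ((mc k).const_mul (2 ^ k))
        ((measurable_trunc hu (ν k)).enorm.pow_const 2).aemeasurable
      have h2 := condLExp_mono (mΩ := m) (P := μ)
        (X := fun x => 2 ^ k * c k x * ‖trunc u (ν k) x‖ₑ ^ 2)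
        (Y := fun y => ‖u y * h y‖ₑ) (by
          filter_upwards [enh2] with x hx
          have h3 : (2 ^ k * ψ k x) ^ 2 ≤ ‖h x‖ₑ ^ 2 := by
            rw [hx, mul_pow, ← pow_mul, mul_comm k, pow_mul]
            refine le_trans (le_of_eq ?_) (ENNReal.le_tsum k)
            norm_num
          have h4 : 2 ^ k * ψ k x ≤ ‖h x‖ₑ := (ENNReal.pow_le_pow_left_iff (by norm_num)).1 h3
          have h5 : ‖trunc u (ν k) x‖ₑ ≤ ‖u x‖ₑ := enorm_indicator_le_enorm_self _ _
          calc 2 ^ k * c k x * ‖trunc u (ν k) x‖ₑ ^ 2 = ‖trunc u (ν k) x‖ₑ * (2 ^ k * ψ k x) := by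
                simp only [hψ]; ring
            _ ≤ ‖u x‖ₑ * ‖h x‖ₑ := by gcongr
            _ = _ := (enorm_mul _ _).symm)
      filter_upwards [h1, h2, ec k] with x h1 h2 hx hxF
      rw [h1, mul_assoc] at h2
      change 2 ^ k * (c k x * e k x) ≤ _ at h2
      rwa [hx, Set.indicator_of_mem hxF, Pi.one_apply, mul_one] at h2
    have null : ∀ᵐ x ∂μ, x ∈ G → ∃ k, x ∈ G ∧ e k x < 16 ^ k := by
      filter_upwards [ae_all_iff.2 low, hcon] with x hx hlt hxG
      by_contra! hno
      have : ∀ k : ℕ, (2 : ℝ≥0∞) ^ k ≤ condLExp m μ (fun y => ‖u y * h y‖ₑ) x :=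
        fun k => hx k ⟨hxG, hno k hxG⟩
      have t := ENNReal.tendsto_pow_atTop_nhds_top_iff.2 ENNReal.one_lt_two
      exact absurd (le_of_tendsto' t this) (not_le.2 hlt)
    have : μ G ≤ ∑' k, δ k := by
      calc μ G ≤ μ (⋃ k, {x ∈ G | e k x < 16 ^ k}) := by
            refine measure_mono_ae ?_
            filter_upwards [null] with x hx hxG
            exact Set.mem_iUnion.2 (hx hxG)
        _ ≤ ∑' k, μ {x ∈ G | e k x < 16 ^ k} := measure_iUnion_le _
        _ ≤ _ := ENNReal.tsum_le_tsum hν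
    exact absurd δsum (not_lt.2 this)

/-- On a piece of finite positive measure, the function just constructed would lie in the kernel
although its product with `u` is not conditionable. -/
theorem condSq_lt_top_of_isClosed_of_measurable (hm : m ≤ m0) [SigmaFinite (μ.trim hm)]
    {w u : X → ℂ} (hu : Measurable u) (hT : (wct m μ w u).IsClosed) :
    ∀ᵐ x ∂μ, condSq m μ u x < ∞ := by
  have key (n : ℕ) : μ ({x | condSq m μ u x = ∞} ∩ spanningSets (μ.trim hm) n) = 0 := by
    by_contra h0
    set G := {x | condSq m μ u x = ∞} ∩ spanningSets (μ.trim hm) n with hG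
    have mS : MeasurableSet[m] (spanningSets (μ.trim hm) n) := measurableSet_spanningSets _ n
    have mG : MeasurableSet[m] G := (measurable_condLExp m μ _ (measurableSet_singleton ∞)).inter mS
    have fin : μ G ≠ ∞ := by
      refine ne_top_of_le_ne_top ?_ (measure_mono (Set.inter_subset_right))
      rw [← trim_measurableSet_eq hm mS]
      exact (measure_spanningSets_lt_top _ n).ne
    obtain ⟨h, hL, hs, hn⟩ := exists_condLExp_enorm_mul_eq_top hm hu mG (fun x hx => hx.1) h0 fin
    refine hn ?_
    have := (mem_pmapKer_wct.1 (mem_pmapKer_of_condSq_eq_top hm hu hT hL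
      (fun x hx => hs x fun h => hx h.1))).1
    refine (this.congr (g := fun y => u y * h y) ?_).2
    filter_upwards [hL.coeFn_toLp] with x hx
    rw [hx]
  have : μ {x | condSq m μ u x = ∞} = 0 := by
    rw [← Set.inter_univ {x | condSq m μ u x = ∞}, ← iUnion_spanningSets (μ.trim hm),
      Set.inter_iUnion]
    exact measure_iUnion_null key
  rw [ae_iff]
  simpa using this

theorem wct_congr {w w' u u' : X → ℂ}
    (h1 : ∀ f : Lp ℂ 2 μ, Conditionable m μ (fun y => u y * f y) ↔
      Conditionable m μ (fun y => u' y * f y))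
    (h2 : ∀ f : Lp ℂ 2 μ, Conditionable m μ (fun y => u y * f y) →
      wctFun m μ w u f =ᵐ[μ] wctFun m μ w' u' f) : wct m μ w u = wct m μ w' u' := by
  have hd : (wct m μ w u).domain = (wct m μ w' u').domain := by
    ext f
    constructor
    · exact fun h => ⟨(h1 f).1 h.1, (memLp_congr_ae (h2 f h.1)).1 h.2⟩
    · exact fun h => ⟨(h1 f).2 h.1, (memLp_congr_ae (h2 f ((h1 f).2 h.1))).2 h.2⟩
  refine LinearPMap.ext hd fun x hx hx' => ?_
  exact Lp.ext ((coeFn_wct ⟨x, hx⟩).trans ((h2 x hx.1).trans (coeFn_wct ⟨x, hx'⟩).symm))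

theorem condSq_congr {f g : X → ℂ} (h : f =ᵐ[μ] g) : condSq m μ f =ᵐ[μ] condSq m μ g :=
  condLExp_congr_ae (by filter_upwards [h] with x hx; rw [hx])

theorem condSq_lt_top_of_isClosed (hm : m ≤ m0) [SigmaFinite (μ.trim hm)]
    {w u : X → ℂ} (hu : AEMeasurable u μ) (hT : (wct m μ w u).IsClosed) :
    ∀ᵐ x ∂μ, condSq m μ u x < ∞ := by
  have h (f : Lp ℂ 2 μ) : (fun y => u y * f y) =ᵐ[μ] fun y => hu.mk u y * f y := by
    filter_upwards [hu.ae_eq_mk] with x hx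
    rw [hx]
  have e : wct m μ w u = wct m μ w (hu.mk u) := by
    refine wct_congr (fun f => ⟨fun hf => hf.congr (h f), fun hf => hf.congr (h f).symm⟩)
      fun f _ => ?_
    filter_upwards [condC_congr (m := m) (h f)] with x hx
    simp only [wctFun, hx]
  rw [e] at hT
  filter_upwards [condSq_congr (m := m) hu.ae_eq_mk,
    condSq_lt_top_of_isClosed_of_measurable hm hu.measurable_mk hT] with x h1 h2
  rwa [h1]

end Finite
end WCT

/-! ### Uniqueness of Moore–Penrose inverses. -/

section MoorePenrose

variable {H₁ H₂ : Type*}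
  [NormedAddCommGroup H₁] [InnerProductSpace ℂ H₁]
  [NormedAddCommGroup H₂] [InnerProductSpace ℂ H₂]

theorem mem_pmapRange {T : H₁ →ₗ.[ℂ] H₂} {y : H₂} : y ∈ pmapRange T ↔ ∃ x : T.domain, T x = y :=
  Iff.rfl

theorem mem_pmapKer {T : H₁ →ₗ.[ℂ] H₂} {x : H₁} :
    x ∈ pmapKer T ↔ ∃ h : x ∈ T.domain, T ⟨x, h⟩ = 0 := by
  rw [pmapKer, Submodule.mem_map]
  constructor
  · rintro ⟨y, hy, rfl⟩
    exact ⟨y.2, hy⟩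
  · rintro ⟨h, hx⟩
    exact ⟨⟨x, h⟩, hx, rfl⟩

variable [CompleteSpace H₁] [CompleteSpace H₂]

theorem Submodule.dense_sup_orthogonal (K : Submodule ℂ H₁) : Dense ((K ⊔ Kᗮ : Submodule ℂ H₁) : Set H₁) := by
  rw [Submodule.dense_iff_topologicalClosure_eq_top, Submodule.topologicalClosure_eq_top_iff,
    ← Submodule.inf_orthogonal, Submodule.inf_orthogonal_eq_bot]

/-- On `Tx + b` with `b ∈ R(T)ᗮ = N(D)`, the value of `D` must be the projection of `x` onto
`N(T)ᗮ`, whatever `D` is. -/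
theorem IsMoorePenroseInverse.unique {T : H₁ →ₗ.[ℂ] H₂} {D D' : H₂ →ₗ.[ℂ] H₁}
    (h : IsMoorePenroseInverse T D) (h' : IsMoorePenroseInverse T D') : D = D' := by
  refine LinearPMap.ext (h.domain_eq.trans h'.domain_eq.symm) fun y hy hy' => ?_
  have hy2 := hy
  rw [h.domain_eq] at hy2
  obtain ⟨a, ha, b, hb, rfl⟩ := Submodule.mem_sup.1 hy2
  obtain ⟨x, rfl⟩ := mem_pmapRange.1 ha
  have hval {D : H₂ →ₗ.[ℂ] H₁} (h : IsMoorePenroseInverse T D) (hy : T x + b ∈ D.domain) :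
      D ⟨T x + b, hy⟩ = (pmapKer T)ᗮ.starProjection (x : H₁) := by
    obtain ⟨h1, e1⟩ := h.inverse_apply x
    rw [← h.ker_eq] at hb
    obtain ⟨h2, e2⟩ := mem_pmapKer.1 hb
    rw [← e1, ← add_zero (D ⟨T x, h1⟩), ← e2, ← LinearPMap.map_add]
    rfl
  rw [hval h hy, hval h' hy']

end MoorePenrose

/-! ### Projections along a weight `v`, and what density of the domain gives. -/

namespace WCT

section Projection

variable {X : Type*} {m : MeasurableSpace X} {m0 : MeasurableSpace X} {μ : Measure[m0] X}

theorem aemeasurable_conj {v : X → ℂ} (hv : AEMeasurable v μ) :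
    AEMeasurable (fun y => conj (v y)) μ :=
  Complex.continuous_conj.measurable.comp_aemeasurable hv

/-- `E` preserves the integral of the pointwise inner product, and the `m`-measurable `c` pulls out.
Orthogonality thus becomes a statement about `E(v̄y)`. -/
theorem inner_toLp_mul (hm : m ≤ m0) [SigmaFinite (μ.trim hm)] {v c : X → ℂ}
    (hv : AEMeasurable v μ) (hB : ∀ᵐ x ∂μ, condSq m μ v x < ∞) (hc : Measurable[m] c)
    (hL : MemLp (fun x => v x * c x) 2 μ) (y : Lp ℂ 2 μ) :
    inner ℂ y (hL.toLp _) = ∫ x, c x * conj (condC m μ (fun z => conj (v z) * y z) x) ∂μ := by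
  have hcond : Conditionable m μ (fun z => conj (v z) * y z) :=
    Conditionable.mul_Lp (aemeasurable_conj hv) (by rwa [condSq_conj]) y
  have hcond' : Conditionable m μ (fun z => conj (conj (v z) * y z)) := by
    refine ⟨aemeasurable_conj hcond.1, ?_⟩
    have : (fun z => ‖conj (conj (v z) * y z)‖ₑ) = fun z => ‖conj (v z) * y z‖ₑ := by
      ext z; rw [← ofReal_norm, ← ofReal_norm, RCLike.norm_conj]
    rw [this]; exact hcond.2
  have e : (fun x => inner ℂ (y x) (hL.toLp _ x)) =ᵐ[μ]
      fun x => c x * conj (conj (v x) * y x) := by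
    filter_upwards [hL.coeFn_toLp] with x hx
    rw [hx, RCLike.inner_apply, map_mul, Complex.conj_conj]
    ring
  have hi := (L2.integrable_inner (𝕜 := ℂ) y (hL.toLp _)).congr e
  rw [L2.inner_def, integral_congr_ae e, ← integral_condC hm hi]
  refine integral_congr_ae ?_
  filter_upwards [condC_mul hm hc hcond'] with x hx
  rw [hx, condC_conj]

/-- The coefficient `E(v̄ y) / E(|v|²)` of the projection onto the module generated by `v`. -/
noncomputable def coef (m : MeasurableSpace X) (μ : Measure[m0] X) (v y : X → ℂ) : X → ℂ := fun x =>
  condC m μ (fun z => conj (v z) * y z) x / ((condSq m μ v x).toReal : ℂ)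

theorem measurable_coef (v y : X → ℂ) : Measurable[m] (coef m μ v y) :=
  (measurable_condC _).div
    (Complex.measurable_ofReal.comp (measurable_condLExp m μ _).ennreal_toReal)

theorem condC_eq_zero_of_condSq_eq_zero (hm : m ≤ m0) [SigmaFinite (μ.trim hm)] {u : X → ℂ}
    (hu : AEMeasurable u μ) (hA : ∀ᵐ x ∂μ, condSq m μ u x < ∞) (f : Lp ℂ 2 μ) :
    ∀ᵐ x ∂μ, condSq m μ u x = 0 → condC m μ (fun y => u y * f y) x = 0 := by
  filter_upwards [enorm_condC_mul_sq_le hm hu (Lp.aestronglyMeasurable f).aemeasurable hA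
    (condSq_lt_top (Lp.memLp f))] with x hx h0
  rw [h0, zero_mul, mul_zero] at hx
  simpa using hx

/-- By conditional Cauchy–Schwarz, `E(|v|²) |coef|² ≤ 16 E(|y|²)`, which is integrable. -/
theorem memLp_mul_coef (hm : m ≤ m0) [SigmaFinite (μ.trim hm)] {v : X → ℂ}
    (hv : AEMeasurable v μ) (hB : ∀ᵐ x ∂μ, condSq m μ v x < ∞) (y : Lp ℂ 2 μ) :
    MemLp (fun x => v x * coef m μ v y x) 2 μ := by
  have mvc : AEMeasurable (fun x => v x * coef m μ v y x) μ :=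
    hv.mul ((measurable_coef v y).mono hm le_rfl).aemeasurable
  rw [memLp_two_iff mvc, lintegral_enorm_mul_sq hm hv (measurable_coef v y)]
  refine lt_of_le_of_lt (lintegral_mono_ae (g := fun x => 16 * condSq m μ y x) ?_) ?_
  · have h := enorm_condC_mul_sq_le hm (μ := μ) (aemeasurable_conj hv)
      (Lp.aestronglyMeasurable y).aemeasurable (by rwa [condSq_conj]) (condSq_lt_top (Lp.memLp y))
    rw [condSq_conj] at h
    filter_upwards [h, hB] with x h hx
    by_cases h0 : condSq m μ v x = 0
    · simp [h0]
    have h2 : (condSq m μ v x).toReal ≠ 0 := (ENNReal.toReal_pos h0 hx.ne).ne'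
    have h3 : ‖((condSq m μ v x).toReal : ℂ)‖ₑ = condSq m μ v x := by
      rw [← ofReal_norm, Complex.norm_real, Real.norm_eq_abs, abs_of_nonneg ENNReal.toReal_nonneg,
        ENNReal.ofReal_toReal hx.ne]
    have hb := ENNReal.mul_inv_cancel h0 hx.ne
    rw [coef, div_eq_mul_inv, enorm_mul, enorm_inv (by exact_mod_cast h2), h3, mul_pow]
    set b := condSq m μ v x
    calc b * (‖condC m μ (fun z => conj (v z) * y z) x‖ₑ ^ 2 * b⁻¹ ^ 2)
        = (b * b⁻¹) * b⁻¹ * ‖condC m μ (fun z => conj (v z) * y z) x‖ₑ ^ 2 := by ring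
      _ ≤ (b * b⁻¹) * b⁻¹ * (16 * (b * condSq m μ y x)) := by gcongr
      _ = (b * b⁻¹) * (b * b⁻¹) * (16 * condSq m μ y x) := by ring
      _ = _ := by rw [hb]; ring
  · rw [condSq, lintegral_const_mul _ (measurable_condLExp' m μ _), lintegral_condLExp hm]
    exact ENNReal.mul_lt_top (by simp) (lintegral_enorm_sq_lt_top (Lp.memLp y))

theorem condC_conj_mul_proj (hm : m ≤ m0) [SigmaFinite (μ.trim hm)] {v : X → ℂ}
    (hv : AEMeasurable v μ) (hB : ∀ᵐ x ∂μ, condSq m μ v x < ∞) (y : Lp ℂ 2 μ) :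
    condC m μ (fun z => conj (v z) * (memLp_mul_coef hm hv hB y).toLp _ z) =ᵐ[μ]
      condC m μ (fun z => conj (v z) * y z) := by
  have e : (fun z => conj (v z) * (memLp_mul_coef hm hv hB y).toLp _ z) =ᵐ[μ]
      fun z => conj (v z) * (v z * coef m μ v y z) := by
    filter_upwards [(memLp_mul_coef hm hv hB y).coeFn_toLp] with x hx
    rw [hx]
  have h0 := condC_eq_zero_of_condSq_eq_zero hm (aemeasurable_conj hv) (by rwa [condSq_conj]) y
  rw [condSq_conj] at h0
  filter_upwards [condC_congr (m := m) e,
    (condC_conj_mul_mul hm hv hB (measurable_coef (m := m) (μ := μ) v y)).2, h0, hB] with x h1 h2 h0 hx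
  rw [h1, h2, coef]
  -- Where `E(|v|²) = 0` the quotient is `0` by convention, and `E(v̄y)` vanishes as well.
  by_cases hz : condSq m μ v x = 0
  · rw [h0 hz]; simp
  · have h2 : ((condSq m μ v x).toReal : ℂ) ≠ 0 := by exact_mod_cast (ENNReal.toReal_pos hz hx.ne).ne'
    field_simp

theorem condC_conj_mul_sub_proj (hm : m ≤ m0) [SigmaFinite (μ.trim hm)] {v : X → ℂ}
    (hv : AEMeasurable v μ) (hB : ∀ᵐ x ∂μ, condSq m μ v x < ∞) (y : Lp ℂ 2 μ) :
    condC m μ (fun z => conj (v z) * (y - (memLp_mul_coef hm hv hB y).toLp _ : Lp ℂ 2 μ) z) =ᵐ[μ]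
      0 := by
  filter_upwards [condC_mul_sub (m := m) (aemeasurable_conj hv) (by rwa [condSq_conj]) y
    ((memLp_mul_coef hm hv hB y).toLp _), condC_conj_mul_proj hm hv hB y] with x h1 h2
  rw [h1, h2, sub_self]; rfl

/-- An exhaustion of the space by `m`-measurable sets of finite measure on which a given
`m`-measurable function is bounded. -/
theorem exists_exhaustion (hm : m ≤ m0) [SigmaFinite (μ.trim hm)] {φ : X → ℝ≥0∞}
    (hφ : Measurable[m] φ) : ∃ F : ℕ → Set X, (∀ n, MeasurableSet[m] (F n)) ∧ (∀ n, μ (F n) < ∞) ∧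
      (∀ n, ∀ x ∈ F n, φ x ≤ n) ∧ ∀ x, φ x < ∞ → ∃ n, x ∈ F n := by
  have mS n : MeasurableSet[m] (spanningSets (μ.trim hm) n) := measurableSet_spanningSets _ n
  refine ⟨fun n => {x | φ x ≤ n} ∩ spanningSets (μ.trim hm) n,
    fun n => (hφ measurableSet_Iic).inter (mS n), fun n => ?_, fun n x hx => hx.1, fun x hx => ?_⟩
  · refine (measure_mono Set.inter_subset_right).trans_lt ?_
    rw [← trim_measurableSet_eq hm (mS n)]
    exact measure_spanningSets_lt_top _ n
  · obtain ⟨k, hk⟩ := ENNReal.exists_nat_gt hx.ne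
    have hx' : x ∈ ⋃ n, spanningSets (μ.trim hm) n := by rw [iUnion_spanningSets]; trivial
    obtain ⟨l, hl⟩ := Set.mem_iUnion.1 hx'
    refine ⟨max k l, hk.le.trans (by exact_mod_cast le_max_left k l), ?_⟩
    exact monotone_spanningSets _ (le_max_right k l) hl

theorem memLp_mul_of_bounded (hm : m ≤ m0) [SigmaFinite (μ.trim hm)] {v c : X → ℂ}
    (hv : AEMeasurable v μ) (hc : Measurable[m] c) {F : Set X} (mF : MeasurableSet[m] F)
    (hF : μ F < ∞) {M : ℝ≥0∞} (hM : M ≠ ∞) (h : ∀ᵐ x ∂μ, x ∈ F → condSq m μ v x * ‖c x‖ₑ ^ 2 ≤ M)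
    (h0 : ∀ x ∉ F, c x = 0) : MemLp (fun x => v x * c x) 2 μ := by
  have mvc : AEMeasurable (fun x => v x * c x) μ := hv.mul (hc.mono hm le_rfl).aemeasurable
  rw [memLp_two_iff mvc, lintegral_enorm_mul_sq hm hv hc]
  refine lt_of_le_of_lt (lintegral_mono_ae (g := F.indicator fun _ => M) ?_) ?_
  · filter_upwards [h] with x hx
    by_cases hxF : x ∈ F
    · simpa [hxF] using hx hxF
    · simp [h0 x hxF]
  · rw [lintegral_indicator_const (hm _ mF)]
    exact ENNReal.mul_lt_top hM.lt_top hF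

/-- For `f` in the domain, `∫ E(|w|²) |E(uf)|² < ∞` forces `E(uf) = 0` where `E(|w|²) = ∞`. This
condition describes the closed kernel of `χ_G E M_u`, so by density it holds for every `f`. -/
theorem condSq_eq_zero_of_dense (hm : m ≤ m0) [SigmaFinite (μ.trim hm)] {w u : X → ℂ}
    (hw : AEMeasurable w μ) (hu : AEMeasurable u μ) (hA : ∀ᵐ x ∂μ, condSq m μ u x < ∞)
    (hdense : Dense ((wct m μ w u).domain : Set (Lp ℂ 2 μ))) :
    ∀ᵐ x ∂μ, condSq m μ w x = ∞ → condSq m μ u x = 0 := by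
  set G : Set X := {x | condSq m μ w x = ∞} with hG
  set T := wct m μ (G.indicator fun _ => 1) u with hT
  have hsub : ((wct m μ w u).domain : Set (Lp ℂ 2 μ)) ⊆ pmapKer T := by
    intro f hf
    refine mem_pmapKer_wct.2 ⟨hf.1, ?_⟩
    have hfin := lintegral_enorm_sq_lt_top hf.2
    have me : Measurable[m] (condC m μ (fun y => u y * f y)) := measurable_condC _
    simp only [wctFun] at hfin
    rw [lintegral_enorm_mul_sq hm hw me] at hfin
    have := ae_lt_top ((measurable_condLExp' m μ _).mul
      ((measurable_enorm.comp (me.mono hm le_rfl)).pow_const 2)) hfin.ne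
    filter_upwards [this] with x hx
    by_cases hxG : x ∈ G
    · have e0 : condC m μ (fun y => u y * f y) x = 0 := by
        by_contra hne
        have h1 : condSq m μ w x = ∞ := hxG
        change condSq m μ w x * ‖condC m μ (fun y => u y * f y) x‖ₑ ^ 2 < ∞ at hx
        rw [h1, ENNReal.top_mul (by simpa using hne)] at hx
        exact lt_irrefl _ hx
      simp [wctFun, e0]
    · simp [wctFun, hxG]
  have hker : ∀ f : Lp ℂ 2 μ, f ∈ pmapKer T := by
    have hc := (isClosed_wct hm (G.indicator fun _ => 1) hu hA).isClosed_pmapKer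
    have := (hdense.mono hsub).closure_eq
    rw [hc.closure_eq] at this
    intro f
    have : f ∈ (pmapKer T : Set (Lp ℂ 2 μ)) := by rw [this]; trivial
    exact this
  obtain ⟨F, mF, hF, hb, hex⟩ := exists_exhaustion hm (μ := μ) (measurable_condLExp m μ fun y => ‖u y‖ₑ ^ 2)
  have key n : ∀ᵐ x ∂μ, x ∈ F n → condSq m μ w x = ∞ → condSq m μ u x = 0 := by
    have mc : Measurable[m] ((F n).indicator fun _ => (1 : ℂ)) := measurable_const.indicator (mF n)
    -- Test function `ū χ_F`, for which `E(uf) = E(|u|²)` on `F`.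
    have hL : MemLp (fun x => conj (u x) * (F n).indicator (fun _ => (1 : ℂ)) x) 2 μ := by
      refine memLp_mul_of_bounded hm (aemeasurable_conj hu) mc (mF n) (hF n)
        (M := n) (by simp) (ae_of_all _ fun x hx => ?_) (fun x hx => by simp [hx])
      rw [condSq_conj]
      simpa [hx, condSq] using hb n x hx
    have h := condC_conj_mul_mul hm (μ := μ) (aemeasurable_conj hu) (by rwa [condSq_conj]) mc
    simp only [Complex.conj_conj, condSq_conj] at h
    have e : (fun y => u y * hL.toLp _ y) =ᵐ[μ]
        fun y => u y * (conj (u y) * (F n).indicator (fun _ => (1 : ℂ)) y) := by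
      filter_upwards [hL.coeFn_toLp] with x hx
      rw [hx]
    filter_upwards [(mem_pmapKer_wct.1 (hker (hL.toLp _))).2, condC_congr (m := m) e, h.2, hA]
      with x h1 h2 h3 hx hxF hxG
    have hxG' : x ∈ G := hxG
    simp only [wctFun, Set.indicator_of_mem hxG', one_mul, Pi.zero_apply] at h1
    rw [h2, h3, Set.indicator_of_mem hxF, mul_one] at h1
    have : (condSq m μ u x).toReal = 0 := by exact_mod_cast h1
    exact ((ENNReal.toReal_eq_zero_iff _).1 this).resolve_right hx.ne
  filter_upwards [ae_all_iff.2 key, hA] with x hx hfin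
  obtain ⟨n, hn⟩ := hex x hfin
  exact hx n hn

end Projection
end WCT

/-! ### The inverse when both conditional squares are finite with the same zero set. -/

namespace WCT

section Inverse

variable {X : Type*} {m : MeasurableSpace X} {m0 : MeasurableSpace X} {μ : Measure[m0] X}

/-- The indicator is absorbed by `1 / 0 = 0`: off `S` one of the two factors vanishes. -/
theorem weightFun_eq (w u : X → ℂ) (x : X) :
    weightFun m μ w u x = 1 / ((condSq m μ u x).toReal * (condSq m μ w x).toReal) := by
  by_cases hx : x ∈ suppSet m μ w u
  · rw [weightFun, Set.indicator_of_mem hx]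
  · rw [weightFun, Set.indicator_of_notMem hx]
    have : condSq m μ u x = 0 ∨ condSq m μ w x = 0 := by
      by_contra! h
      exact hx h
    rcases this with h | h <;> simp [h]

theorem measurable_weightFun (w u : X → ℂ) : Measurable[m] (weightFun m μ w u) := by
  have e : weightFun m μ w u =
      fun x => 1 / ((condSq m μ u x).toReal * (condSq m μ w x).toReal) :=
    funext (weightFun_eq w u)
  rw [e]
  exact measurable_const.div ((measurable_condLExp m μ _).ennreal_toReal.mul
    (measurable_condLExp m μ _).ennreal_toReal)

/-- The operator `M_{χ_S / (E(|u|²) E(|v|²))} M_{ū} E M_{v̄}`. -/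
noncomputable def mpInv (m : MeasurableSpace X) (μ : Measure[m0] X) (v u : X → ℂ) :
    Lp ℂ 2 μ →ₗ.[ℂ] Lp ℂ 2 μ :=
  wct m μ (fun x => (weightFun m μ v u x : ℂ) * conj (u x)) (fun x => conj (v x))

theorem wctFun_mpInv (v u g : X → ℂ) :
    wctFun m μ (fun x => (weightFun m μ v u x : ℂ) * conj (u x)) (fun x => conj (v x)) g =
      mpFun m μ v u g := by
  ext x; simp only [wctFun, mpFun, mul_assoc]

variable {v u : X → ℂ}

theorem mem_mpInv_domain (hv : AEMeasurable v μ)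
    (hB : ∀ᵐ x ∂μ, condSq m μ v x < ∞)
    {g : Lp ℂ 2 μ} :
    g ∈ (mpInv m μ v u).domain ↔ MemLp (mpFun m μ v u g) 2 μ := by
  rw [← wctFun_mpInv]
  exact ⟨fun h => h.2, fun h => ⟨Conditionable.mul_Lp (aemeasurable_conj hv)
    (by rwa [condSq_conj]) g, h⟩⟩

theorem mem_pmapKer_mpInv_of_condC_eq_zero (hv : AEMeasurable v μ)
    (hB : ∀ᵐ x ∂μ, condSq m μ v x < ∞)
    {g : Lp ℂ 2 μ}
    (hg : condC m μ (fun z => conj (v z) * g z) =ᵐ[μ] 0) : g ∈ pmapKer (mpInv m μ v u) := by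
  refine mem_pmapKer_wct.2 ⟨Conditionable.mul_Lp (aemeasurable_conj hv) (by rwa [condSq_conj]) g, ?_⟩
  filter_upwards [hg] with x hx
  simp [wctFun, hx]

theorem inner_toLp_mul_eq_zero (hm : m ≤ m0) [SigmaFinite (μ.trim hm)]
    (hv : AEMeasurable v μ) (hB : ∀ᵐ x ∂μ, condSq m μ v x < ∞)
    {c : X → ℂ} (hc : Measurable[m] c)
    (hL : MemLp (fun x => v x * c x) 2 μ) {y : Lp ℂ 2 μ}
    (h : ∀ᵐ x ∂μ, c x = 0 ∨ condC m μ (fun z => conj (v z) * y z) x = 0) :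
    inner ℂ y (hL.toLp _) = 0 := by
  rw [inner_toLp_mul hm hv hB hc hL y]
  refine integral_eq_zero_of_ae ?_
  filter_upwards [h] with x hx
  rcases hx with hx | hx <;> simp [hx]

theorem mem_range_orthogonal_of_condC_eq_zero (hm : m ≤ m0) [SigmaFinite (μ.trim hm)]
    (hv : AEMeasurable v μ) (hB : ∀ᵐ x ∂μ, condSq m μ v x < ∞)
    {y : Lp ℂ 2 μ}
    (hy : condC m μ (fun z => conj (v z) * y z) =ᵐ[μ] 0) : y ∈ (pmapRange (wct m μ v u))ᗮ := by
  rw [Submodule.mem_orthogonal']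
  rintro _ ⟨x, rfl⟩
  exact inner_toLp_mul_eq_zero hm hv hB (measurable_condC _) x.2.2
    (hy.mono fun x hx => .inr hx)

/-- Write `e = E(v̄y)`. Testing against `T(ū χ_F e) = v E(|u|²) χ_F e` gives `∫_F E(|u|²) |e|² = 0`,
so `e = 0` where `E(|u|²) ≠ 0`. Elsewhere `E(|v|²) = 0`, and Cauchy–Schwarz gives `e = 0`. -/
theorem condC_eq_zero_of_mem_range_orthogonal (hm : m ≤ m0) [SigmaFinite (μ.trim hm)]
    (hv : AEMeasurable v μ) (hu : AEMeasurable u μ) (hB : ∀ᵐ x ∂μ, condSq m μ v x < ∞)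
    (hA : ∀ᵐ x ∂μ, condSq m μ u x < ∞) (hS : ∀ᵐ x ∂μ, condSq m μ u x = 0 ↔ condSq m μ v x = 0)
    {y : Lp ℂ 2 μ}
    (hy : y ∈ (pmapRange (wct m μ v u))ᗮ) :
    condC m μ (fun z => conj (v z) * y z) =ᵐ[μ] 0 := by
  set A := condSq m μ u with hAdef
  set B := condSq m μ v with hBdef
  set e := condC m μ (fun z => conj (v z) * y z) with he
  have mA : Measurable[m] A := measurable_condLExp m μ _
  have mB : Measurable[m] B := measurable_condLExp m μ _
  have me : Measurable[m] e := measurable_condC _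
  have mφ : Measurable[m] fun x => A x + B x + ‖e x‖ₑ :=
    (mA.add mB).add (measurable_enorm.comp me)
  obtain ⟨F, mF, hF, hb, hex⟩ := exists_exhaustion hm (μ := μ) mφ
  have key n : ∀ᵐ x ∂μ, x ∈ F n → e x = 0 := by
    have bA {x} (hx : x ∈ F n) : A x ≤ n := le_self_add.trans (le_self_add.trans (hb n x hx))
    have bB {x} (hx : x ∈ F n) : B x ≤ n := le_add_self.trans (le_self_add.trans (hb n x hx))
    have be {x} (hx : x ∈ F n) : ‖e x‖ₑ ≤ n := le_add_self.trans (hb n x hx)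
    set a : X → ℂ := (F n).indicator e with ha
    have ma : Measurable[m] a := me.indicator (mF n)
    set c : X → ℂ := fun x => ((A x).toReal : ℂ) * a x with hc
    have mc : Measurable[m] c := (Complex.measurable_ofReal.comp mA.ennreal_toReal).mul ma
    have enA (x) : ‖((A x).toReal : ℂ)‖ₑ ≤ A x := by
      rw [← ofReal_norm, Complex.norm_real, Real.norm_eq_abs, abs_of_nonneg ENNReal.toReal_nonneg]
      exact ENNReal.ofReal_toReal_le
    have hLx : MemLp (fun x => conj (u x) * a x) 2 μ := by
      refine memLp_mul_of_bounded hm (aemeasurable_conj hu) ma (mF n) (hF n) (M := n * n ^ 2)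
        (by finiteness) (ae_of_all _ fun x hx => ?_) (fun x hx => by simp [ha, hx])
      rw [condSq_conj]
      have := be hx
      have := bA hx
      simp only [ha, Set.indicator_of_mem hx]
      gcongr
    have hLy : MemLp (fun x => v x * c x) 2 μ := by
      refine memLp_mul_of_bounded hm hv mc (mF n) (hF n) (M := n * (n * n) ^ 2)
        (by finiteness) (ae_of_all _ fun x hx => ?_) (fun x hx => by simp [hc, ha, hx])
      have h1 := be hx
      have h2 := (enA x).trans (bA hx)
      have h3 := bB hx
      simp only [hc, ha, Set.indicator_of_mem hx, enorm_mul]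
      gcongr
    have hx := condC_conj_mul_mul hm (μ := μ) (aemeasurable_conj hu) (by rwa [condSq_conj]) ma
    simp only [Complex.conj_conj, condSq_conj] at hx
    have ev : (fun y => u y * hLx.toLp _ y) =ᵐ[μ] fun y => u y * (conj (u y) * a y) := by
      filter_upwards [hLx.coeFn_toLp] with x hx
      rw [hx]
    have hval : wctFun m μ v u (hLx.toLp _) =ᵐ[μ] fun x => v x * c x := by
      filter_upwards [condC_congr (m := m) ev, hx.2] with x h1 h2
      simp only [wctFun, h1, h2, hc]
      rfl
    have hdom : hLx.toLp _ ∈ (wct m μ v u).domain :=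
      ⟨hx.1.congr ev.symm, (memLp_congr_ae hval).2 hLy⟩
    have hT : wct m μ v u ⟨_, hdom⟩ = hLy.toLp _ :=
      Lp.ext ((coeFn_wct ⟨_, hdom⟩).trans (hval.trans hLy.coeFn_toLp.symm))
    have h0 := (Submodule.mem_orthogonal' _ _).1 hy _ (mem_pmapRange.2 ⟨_, hT⟩)
    rw [inner_toLp_mul hm hv hB mc hLy y] at h0
    set ρ : X → ℝ := (F n).indicator fun x => (A x).toReal * ‖e x‖ ^ 2 with hρ
    have hcρ : (fun x => c x * conj (e x)) = fun x => ((ρ x : ℝ) : ℂ) := by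
      ext x
      by_cases hxF : x ∈ F n
      · simp only [hc, ha, hρ, Set.indicator_of_mem hxF]
        rw [mul_assoc, Complex.mul_conj, Complex.normSq_eq_norm_sq]
        push_cast; rfl
      · simp [hc, ha, hρ, hxF]
    have h0' : ∫ x, ρ x ∂μ = 0 := by
      have : ∫ x, ((ρ x : ℝ) : ℂ) ∂μ = 0 := by rw [← hcρ]; exact h0
      rw [integral_complex_ofReal] at this
      exact_mod_cast this
    have mρ : Measurable ρ :=
      (((mA.mono hm le_rfl).ennreal_toReal).mul ((me.mono hm le_rfl).norm.pow_const 2)).indicator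
        (hm _ (mF n))
    have hint : Integrable ρ μ := by
      rw [hρ, integrable_indicator_iff (hm _ (mF n))]
      refine Measure.integrableOn_of_bounded (M := n * n ^ 2) (hF n).ne
        (((mA.mono hm le_rfl).ennreal_toReal).mul
          ((me.mono hm le_rfl).norm.pow_const 2)).aestronglyMeasurable ?_
      refine (ae_restrict_iff' (hm _ (mF n))).2 (ae_of_all _ fun x hx => ?_)
      have h1 : ‖e x‖ ≤ n := by
        have := be hx
        rw [← ofReal_norm] at this
        simpa using ENNReal.toReal_mono (by simp) this
      have h2 : (A x).toReal ≤ n := by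
        simpa using ENNReal.toReal_mono (by simp) (bA hx)
      rw [Real.norm_eq_abs, abs_of_nonneg (by positivity)]
      gcongr
    have hρ0 : ∀ x, 0 ≤ ρ x := fun x => Set.indicator_nonneg (fun _ _ => by positivity) x
    have := (integral_eq_zero_iff_of_nonneg hρ0 hint).1 h0'
    have hzero := condC_eq_zero_of_condSq_eq_zero hm (aemeasurable_conj hv)
      (by rwa [condSq_conj]) y
    rw [condSq_conj] at hzero
    filter_upwards [this, hS, hA, hzero] with x h1 h2 h3 h4 hxF
    simp only [hρ, Set.indicator_of_mem hxF, Pi.zero_apply, mul_eq_zero, ne_eq, OfNat.ofNat_ne_zero,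
      not_false_eq_true, pow_eq_zero_iff, norm_eq_zero] at h1
    rcases h1 with h1 | h1
    · exact h4 (h2.1 (((ENNReal.toReal_eq_zero_iff _).1 h1).resolve_right h3.ne))
    · exact h1
  filter_upwards [ae_all_iff.2 key, hA, hB] with x hx h1 h2
  obtain ⟨n, hn⟩ := hex x (ENNReal.add_lt_top.2 ⟨ENNReal.add_lt_top.2 ⟨h1, h2⟩, enorm_lt_top⟩)
  exact hx n hn

theorem isMoorePenroseInverse_mpInv (hm : m ≤ m0) [SigmaFinite (μ.trim hm)]
    (hv : AEMeasurable v μ) (hu : AEMeasurable u μ) (hB : ∀ᵐ x ∂μ, condSq m μ v x < ∞)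
    (hA : ∀ᵐ x ∂μ, condSq m μ u x < ∞) (hS : ∀ᵐ x ∂μ, condSq m μ u x = 0 ↔ condSq m μ v x = 0)
    :
    IsMoorePenroseInverse (wct m μ v u) (mpInv m μ v u) := by
  have hu' := aemeasurable_conj hu
  have hA' : ∀ᵐ x ∂μ, condSq m μ (fun y => conj (u y)) x < ∞ := by rwa [condSq_conj]
  -- `P` and `Q` are the candidate projections `x ↦ ū E(ux)/E(|u|²)` and `y ↦ v E(v̄y)/E(|v|²)`; the
  -- proof shows `DT = P` and `TD = Q`.
  set P : Lp ℂ 2 μ → Lp ℂ 2 μ := fun x => (memLp_mul_coef hm hu' hA' x).toLp _ with hP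
  set Q : Lp ℂ 2 μ → Lp ℂ 2 μ := fun y => (memLp_mul_coef hm hv hB y).toLp _ with hQ
  have hPz (x) : condC m μ (fun z => u z * (x - P x : Lp ℂ 2 μ) z) =ᵐ[μ] 0 := by
    simpa only [Complex.conj_conj] using condC_conj_mul_sub_proj hm hu' hA' x
  have hQo (y) : y - Q y ∈ (pmapRange (wct m μ v u))ᗮ :=
    mem_range_orthogonal_of_condC_eq_zero hm hv hB (condC_conj_mul_sub_proj hm hv hB y)
  have orth {y : Lp ℂ 2 μ} (hy : y ∈ (pmapRange (wct m μ v u))ᗮ) : y ∈ pmapKer (mpInv m μ v u) :=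
    mem_pmapKer_mpInv_of_condC_eq_zero hv hB (condC_eq_zero_of_mem_range_orthogonal hm hv hu hB hA hS hy)
  have hTD (y : (mpInv m μ v u).domain) : ∃ h : mpInv m μ v u y ∈ (wct m μ v u).domain,
      wct m μ v u ⟨mpInv m μ v u y, h⟩ = Q y := by
    -- `Dy = ū c`, hence `TDy = v E(|u|²) c`, and the factor `E(|u|²)` cancels against the weight.
    set c : X → ℂ := fun x => (weightFun m μ v u x : ℂ) *
      condC m μ (fun z => conj (v z) * (y : Lp ℂ 2 μ) z) x with hc
    have mc : Measurable[m] c :=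
      (Complex.measurable_ofReal.comp (measurable_weightFun v u)).mul (measurable_condC _)
    have h := condC_conj_mul_mul hm (μ := μ) hu' hA' mc
    simp only [Complex.conj_conj, condSq_conj] at h
    have ev : (fun z => u z * mpInv m μ v u y z) =ᵐ[μ] fun z => u z * (conj (u z) * c z) := by
      have e1 : (mpInv m μ v u y : X → ℂ) =ᵐ[μ] _ := coeFn_wct y
      filter_upwards [e1] with x hx
      rw [hx]
      simp only [wctFun, hc]
      ring
    have hval : wctFun m μ v u (mpInv m μ v u y) =ᵐ[μ] fun x => v x * coef m μ v y x := by
      filter_upwards [condC_congr (m := m) ev, h.2, hA, hS] with x h1 h2 h3 h4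
      rw [wctFun, h1, h2]
      simp only [hc, weightFun_eq, coef]
      congr 1
      by_cases hz : condSq m μ u x = 0
      · simp [hz, h4.1 hz]
      · have : ((condSq m μ u x).toReal : ℂ) ≠ 0 := by
          exact_mod_cast (ENNReal.toReal_pos hz h3.ne).ne'
        push_cast
        field_simp
    have hdom : mpInv m μ v u y ∈ (wct m μ v u).domain :=
      ⟨h.1.congr ev.symm, (memLp_congr_ae hval).2 (memLp_mul_coef hm hv hB y)⟩
    exact ⟨hdom, Lp.ext ((coeFn_wct ⟨_, hdom⟩).trans
      (hval.trans (memLp_mul_coef hm hv hB _).coeFn_toLp.symm))⟩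
  have hDT (x : (wct m μ v u).domain) : ∃ h : wct m μ v u x ∈ (mpInv m μ v u).domain,
      mpInv m μ v u ⟨wct m μ v u x, h⟩ = P x := by
    set e : X → ℂ := condC m μ (fun z => u z * (x : Lp ℂ 2 μ) z) with he
    have me : Measurable[m] e := measurable_condC _
    have h := condC_conj_mul_mul hm (μ := μ) hv hB me
    have ev : (fun z => conj (v z) * wct m μ v u x z) =ᵐ[μ] fun z => conj (v z) * (v z * e z) := by
      filter_upwards [coeFn_wct x] with z hz
      rw [hz]; rfl
    have hval : mpFun m μ v u (wct m μ v u x) =ᵐ[μ]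
        fun z => conj (u z) * coef m μ (fun y => conj (u y)) x z := by
      filter_upwards [condC_congr (m := m) ev, h.2, hB, hS] with z h1 h2 h3 h4
      simp only [mpFun, h1, h2, weightFun_eq, coef, condSq_conj, Complex.conj_conj]
      by_cases hz : condSq m μ v z = 0
      · simp [hz, h4.2 hz]
      · have : ((condSq m μ v z).toReal : ℂ) ≠ 0 := by
          exact_mod_cast (ENNReal.toReal_pos hz h3.ne).ne'
        push_cast
        rw [he]
        field_simp
    have hdom : wct m μ v u x ∈ (mpInv m μ v u).domain :=
      (mem_mpInv_domain hv hB).2 ((memLp_congr_ae hval).2 (memLp_mul_coef hm hu' hA' x))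
    refine ⟨hdom, Lp.ext ?_⟩
    have e1 : (mpInv m μ v u ⟨wct m μ v u x, hdom⟩ : X → ℂ) =ᵐ[μ] _ := coeFn_wct _
    rw [wctFun_mpInv] at e1
    exact e1.trans (hval.trans (memLp_mul_coef hm hu' hA' _).coeFn_toLp.symm)
  have hdomeq : (mpInv m μ v u).domain =
      pmapRange (wct m μ v u) ⊔ (pmapRange (wct m μ v u))ᗮ := by
    apply le_antisymm
    · intro y hy
      obtain ⟨h, e⟩ := hTD ⟨y, hy⟩
      rw [← add_sub_cancel (Q y) y]
      exact Submodule.add_mem_sup (mem_pmapRange.2 ⟨_, e⟩) (hQo y)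
    · refine sup_le ?_ fun y hy => (mem_pmapKer.1 (orth hy)).1
      rintro _ ⟨x, rfl⟩
      exact (hDT x).1
  refine ⟨isClosed_wct hm _ (aemeasurable_conj hv) (by rwa [condSq_conj]), ?_, hdomeq, ?_, ?_, ?_⟩
  · rw [hdomeq]
    exact Submodule.dense_sup_orthogonal _
  · intro y
    obtain ⟨h, e⟩ := hTD y
    refine ⟨h, ?_⟩
    rw [e]
    refine (Submodule.eq_starProjection_of_mem_orthogonal
      (Submodule.le_topologicalClosure _ (mem_pmapRange.2 ⟨_, e⟩)) ?_).symm
    rw [Submodule.orthogonal_closure]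
    exact hQo y
  · intro x
    obtain ⟨h, e⟩ := hDT x
    refine ⟨h, ?_⟩
    rw [e]
    refine (Submodule.eq_starProjection_of_mem_orthogonal ?_ ?_).symm
    · rw [Submodule.mem_orthogonal]
      intro z hz
      refine inner_toLp_mul_eq_zero hm hu' hA' (measurable_coef _ _) (memLp_mul_coef hm hu' hA' x) ?_
      obtain ⟨hz1, hz2⟩ := mem_pmapKer_wct.1 hz
      have me : Measurable[m] (condC m μ (fun y => u y * z y)) := measurable_condC _
      have h0 := (condC_conj_mul_mul hm hv hB me).2
      -- Membership of `z` in the kernel only says `v E(uz) = 0`. Multiplying by `v̄` and applying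
      -- `E` gives `E(|v|²) E(uz) = 0`, an `m`-measurable alternative.
      have h1 : condC m μ (fun y => conj (v y) * (v y * condC m μ (fun y => u y * z y) y)) =ᵐ[μ]
          fun _ => 0 := by
        rw [← condC_zero (m := m) (μ := μ)]
        refine condC_congr ?_
        filter_upwards [hz2] with y hy
        have : v y * condC m μ (fun y => u y * z y) y = 0 := hy
        rw [this, mul_zero]
      filter_upwards [h0, h1, hB, hS] with y h0 h1 h2 h3
      rw [h1, eq_comm, mul_eq_zero] at h0
      rcases h0 with h0 | h0
      · left
        have : (condSq m μ v y).toReal = 0 := by exact_mod_cast h0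
        have := h3.2 (((ENNReal.toReal_eq_zero_iff _).1 this).resolve_right h2.ne)
        simp [coef, condSq_conj, this]
      · right
        simpa only [Complex.conj_conj] using h0
    · refine Submodule.le_orthogonal_orthogonal _ (mem_pmapKer_wct.2
        ⟨Conditionable.mul_Lp hu hA _, ?_⟩)
      filter_upwards [hPz x] with y hy
      simp only [wctFun, hy, Pi.zero_apply, mul_zero]
  · refine le_antisymm (fun y hy => ?_) fun y hy => orth hy
    obtain ⟨h, e⟩ := mem_pmapKer.1 hy
    obtain ⟨h', e'⟩ := hTD ⟨y, h⟩
    have : Q y = 0 := by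
      rw [← e']
      have : (⟨mpInv m μ v u ⟨y, h⟩, h'⟩ : (wct m μ v u).domain) = 0 := Subtype.ext e
      rw [this, LinearPMap.map_zero]
    have := hQo y
    rwa [‹Q y = 0›, sub_zero] at this

end Inverse
end WCT

/-! ### Reduction to the common support `S`. -/

namespace WCT

section Reduction

variable {X : Type*} {m : MeasurableSpace X} {m0 : MeasurableSpace X} {μ : Measure[m0] X}

theorem measurableSet_suppSet (w u : X → ℂ) : MeasurableSet[m] (suppSet m μ w u) :=
  (measurable_condLExp m μ _ (measurableSet_singleton 0).compl).inter
    (measurable_condLExp m μ _ (measurableSet_singleton 0).compl)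

theorem condSq_indicator (hm : m ≤ m0) [SigmaFinite (μ.trim hm)] {H : Set X}
    (hH : MeasurableSet[m] H) {f : X → ℂ} (hf : AEMeasurable f μ) :
    condSq m μ (H.indicator f) =ᵐ[μ] H.indicator (condSq m μ f) := by
  have e : (fun y => ‖H.indicator f y‖ₑ ^ 2) = H.indicator fun y => ‖f y‖ₑ ^ 2 := by
    ext y; by_cases hy : y ∈ H <;> simp [hy]
  rw [condSq, e]
  exact condLExp_indicator hm hH (hf.enorm.pow_const 2)

/-- Off `S`, either `E(|u|²) = 0` and then `E(uf) = 0`, or `E(|w|²) = 0` and then `w = 0`. -/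
theorem wctFun_indicator_suppSet (hm : m ≤ m0) [SigmaFinite (μ.trim hm)] {w u : X → ℂ}
    (hw : AEMeasurable w μ) (hu : AEMeasurable u μ) (hA : ∀ᵐ x ∂μ, condSq m μ u x < ∞)
    (f : Lp ℂ 2 μ) :
    wctFun m μ w u f =ᵐ[μ] wctFun m μ ((suppSet m μ w u).indicator w)
      ((suppSet m μ w u).indicator u) f := by
  set S := suppSet m μ w u with hS
  have e : (fun y => S.indicator u y * f y) = S.indicator fun y => u y * f y := by
    ext y; by_cases hy : y ∈ S <;> simp [hy]
  filter_upwards [condC_indicator hm (measurableSet_suppSet (m := m) (μ := μ) w u)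
    (hu.mul (Lp.aestronglyMeasurable f).aemeasurable),
    condC_eq_zero_of_condSq_eq_zero hm hu hA f,
    ae_eq_zero_of_condLExp_eq_zero hm (hw.enorm.pow_const 2)] with x h1 h2 h3
  simp only [wctFun, e]
  by_cases hx : x ∈ S
  · rw [Set.indicator_of_mem hx]
    congr 1
    exact (h1.trans (Set.indicator_of_mem hx _)).symm
  · rw [Set.indicator_of_notMem hx, zero_mul]
    have : condSq m μ u x = 0 ∨ condSq m μ w x = 0 := by
      by_contra! h
      exact hx h
    rcases this with h | h
    · rw [h2 h, mul_zero]
    · have : w x = 0 := by simpa using h3 h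
      rw [this, zero_mul]

theorem mpFun_indicator_suppSet (hm : m ≤ m0) [SigmaFinite (μ.trim hm)] {w u : X → ℂ}
    (hw : AEMeasurable w μ) (hu : AEMeasurable u μ) (g : Lp ℂ 2 μ) :
    mpFun m μ ((suppSet m μ w u).indicator w) ((suppSet m μ w u).indicator u) g =ᵐ[μ]
      mpFun m μ w u g := by
  have mS := measurableSet_suppSet (m := m) (μ := μ) w u
  have e : (fun y => conj ((suppSet m μ w u).indicator w y) * g y) =
      (suppSet m μ w u).indicator fun y => conj (w y) * g y := by
    ext y; by_cases hy : y ∈ suppSet m μ w u <;> simp [hy]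
  filter_upwards [condSq_indicator hm mS hw, condSq_indicator hm mS hu,
    condC_indicator hm mS ((aemeasurable_conj hw).mul (Lp.aestronglyMeasurable g).aemeasurable)]
    with x h1 h2 h3
  by_cases hx : x ∈ suppSet m μ w u
  · have h3' : condC m μ ((suppSet m μ w u).indicator fun y => conj (w y) * g y) x =
        condC m μ (fun y => conj (w y) * g y) x := h3.trans (Set.indicator_of_mem hx _)
    simp only [mpFun, weightFun_eq, h1, h2, e, h3', Set.indicator_of_mem hx]
  · have : weightFun m μ w u x = 0 := Set.indicator_of_notMem hx _
    simp only [mpFun, this, weightFun_eq, h1, h2, Set.indicator_of_notMem hx]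
    simp

/-- Makes the conditionability clause in the description of the domain automatic. -/
theorem condLExp_lt_top_of_mem_suppSet (hm : m ≤ m0) [SigmaFinite (μ.trim hm)] {w u : X → ℂ}
    (hw : AEMeasurable w μ)
    (hB : ∀ᵐ x ∂μ, x ∈ suppSet m μ w u → condSq m μ w x < ∞) (g : Lp ℂ 2 μ) :
    ∀ᵐ x ∂μ, x ∈ suppSet m μ w u → condLExp m μ (fun y => ‖w y * g y‖ₑ) x < ∞ := by
  simp only [enorm_mul]
  filter_upwards [hB, condSq_lt_top (m := m) (Lp.memLp g),
    condLExp_mul_lt_top (m := m) (g := fun y => ‖g y‖ₑ) hw.enorm] with x h1 h2 h3 hx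
    using h3 (h1 hx) h2

theorem isMoorePenroseInverse_and_mpFun (hm : m ≤ m0) [SigmaFinite (μ.trim hm)] {w u : X → ℂ}
    (hw : AEMeasurable w μ) (hu : AEMeasurable u μ) (hA : ∀ᵐ x ∂μ, condSq m μ u x < ∞)
    (hdense : Dense ((wct m μ w u).domain : Set (Lp ℂ 2 μ))) :
    ∃ D : Lp ℂ 2 μ →ₗ.[ℂ] Lp ℂ 2 μ, IsMoorePenroseInverse (wct m μ w u) D ∧
      (∀ g : Lp ℂ 2 μ, g ∈ D.domain ↔
        (∀ᵐ x ∂μ, x ∈ suppSet m μ w u → condLExp m μ (fun y => ‖w y * g y‖ₑ) x < ∞) ∧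
          MemLp (mpFun m μ w u g) 2 μ) ∧
      ∀ g : D.domain, (D g : X → ℂ) =ᵐ[μ] mpFun m μ w u (g : Lp ℂ 2 μ) := by
  have mS := measurableSet_suppSet (m := m) (μ := μ) w u
  -- Density enters here: `E(|w|²)` can be infinite only where `E(|u|²) = 0`, that is, off `S`.
  have hBS : ∀ᵐ x ∂μ, x ∈ suppSet m μ w u → condSq m μ w x < ∞ := by
    filter_upwards [condSq_eq_zero_of_dense hm hw hu hA hdense] with x hx hxS
    exact lt_top_iff_ne_top.2 fun h => hxS.1 (hx h)
  set v' := (suppSet m μ w u).indicator w with hv'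
  set u' := (suppSet m μ w u).indicator u with hu'
  have mv : AEMeasurable v' μ := hw.indicator (hm _ mS)
  have mu : AEMeasurable u' μ := hu.indicator (hm _ mS)
  have hB' : ∀ᵐ x ∂μ, condSq m μ v' x < ∞ := by
    filter_upwards [condSq_indicator hm mS hw, hBS] with x h1 h2
    rw [h1]
    by_cases hx : x ∈ suppSet m μ w u
    · rw [Set.indicator_of_mem hx]; exact h2 hx
    · simp [hx]
  have hA' : ∀ᵐ x ∂μ, condSq m μ u' x < ∞ := by
    filter_upwards [condSq_indicator hm mS hu, hA] with x h1 h2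
    rw [h1]
    exact (Set.indicator_le_self _ _ x).trans_lt h2
  have hS' : ∀ᵐ x ∂μ, condSq m μ u' x = 0 ↔ condSq m μ v' x = 0 := by
    filter_upwards [condSq_indicator hm mS hu, condSq_indicator hm mS hw] with x h1 h2
    rw [h1, h2]
    by_cases hx : x ∈ suppSet m μ w u
    · rw [Set.indicator_of_mem hx, Set.indicator_of_mem hx]
      exact iff_of_false hx.1 hx.2
    · simp [hx]
  have hT : wct m μ w u = wct m μ v' u' := wct_congr
    (fun f => iff_of_true (Conditionable.mul_Lp hu hA f) (Conditionable.mul_Lp mu hA' f))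
    (fun f _ => wctFun_indicator_suppSet hm hw hu hA f)
  refine ⟨mpInv m μ v' u', ?_, fun g => ?_, fun g => ?_⟩
  · rw [hT]
    exact isMoorePenroseInverse_mpInv hm mv mu hB' hA' hS'
  · rw [mem_mpInv_domain mv hB', memLp_congr_ae (mpFun_indicator_suppSet hm hw hu g)]
    exact (and_iff_right (condLExp_lt_top_of_mem_suppSet hm hw hBS g)).symm
  · have h : (mpInv m μ v' u' g : X → ℂ) =ᵐ[μ] _ := coeFn_wct g
    rw [wctFun_mpInv] at h
    exact h.trans (mpFun_indicator_suppSet hm hw hu g)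

end Reduction
end WCT

theorem theorem2p7 {X : Type*} {m0 : MeasurableSpace X} (μ : Measure X)
    (m : MeasurableSpace X) (hm : m ≤ m0) [SigmaFinite (μ.trim hm)]
    (w u : X → ℂ) (hw : WCT.Conditionable m μ w) (hu : WCT.Conditionable m μ u)
    (hdense : Dense ((WCT.wct m μ w u).domain : Set (Lp ℂ 2 μ))) :
    ((∀ᵐ x ∂μ, WCT.condSq m μ u x < ∞) → (WCT.wct m μ w u).IsClosed) ∧
    ((WCT.wct m μ w u).IsClosed →
      (∃! D : Lp ℂ 2 μ →ₗ.[ℂ] Lp ℂ 2 μ, IsMoorePenroseInverse (WCT.wct m μ w u) D) ∧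
      ∀ D : Lp ℂ 2 μ →ₗ.[ℂ] Lp ℂ 2 μ, IsMoorePenroseInverse (WCT.wct m μ w u) D →
        (∀ g : Lp ℂ 2 μ, g ∈ D.domain ↔
          (∀ᵐ x ∂μ, x ∈ WCT.suppSet m μ w u →
            condLExp m μ (fun y => ‖w y * g y‖ₑ) x < ∞) ∧
          MemLp (WCT.mpFun m μ w u g) 2 μ) ∧
        ∀ g : D.domain, (D g : X → ℂ) =ᵐ[μ] WCT.mpFun m μ w u (g : Lp ℂ 2 μ)) := by
  refine ⟨fun hA => WCT.isClosed_wct hm w hu.1 hA, fun hT => ?_⟩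
  have hA := WCT.condSq_lt_top_of_isClosed hm hu.1 hT
  obtain ⟨D₀, h₀, hdom, hval⟩ := WCT.isMoorePenroseInverse_and_mpFun hm hw.1 hu.1 hA hdense
  refine ⟨⟨D₀, h₀, fun D hD => hD.unique h₀⟩, fun D hD => ?_⟩
  obtain rfl := hD.unique h₀
  exact ⟨hdom, hval⟩
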